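/- Let $\mathcal B$ be a body: a nonempty $3$-dimensional smooth manifold together with a reference configuration, i.e. a smooth embedding $\phi_0:\mathcal B\to\mathbb R^3$ (a diffeomorphism onto an open subset). Let $\Pi^1(\mathcal B,\mathcal B)$ be the $1$-jets groupoid, the Lie groupoid over $\mathcal B$ of all linear isomorphisms $T_X\mathcal B\to T_Y\mathcal B$, $X,Y\in\mathcal B$ (source $X$, target $Y$), with composition as product and with the smooth structure given by the coordinates of source and target and the Jacobian matrix. Let $V$ be a real normed space and let $W:\Pi^1(\mathcal B,\mathcal B)\to V$ be a mechanical response: a smooth map such that $W\big(D\phi_0(Z)^{-1}\circ D\phi_0(Y)\circ g\big)=W(g)$ for all $g:T_X\mathcal B\to T_Y\mathcal B$ in $\Pi^1(\mathcal B,\mathcal B)$ and all $Z\in\mathcal B$. A material isomorphism from $X$ to $Y$ is an isomorphism $g:T_X\mathcal B\to T_Y\mathcal B$ with $W(k\circ g)=W(k)$ for all $k\in\Pi^1(\mathcal B,\mathcal B)$ with source $Y$. The material groupoid $\Omega(\mathcal B)$ is the subgroupoid of $\Pi^1(\mathcal B,\mathcal B)$ (over $\mathcal B$) of all material isomorphisms.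 The body is uniform if any two points are joined by a material isomorphism. A smooth field of material isomorphisms at $X$ on an open set $U'\subseteq\mathcal B$ is a smooth map $P:U'\to\Pi^1(\mathcal B,\mathcal B)$ such that each $P(Z)$ is a material isomorphism from $Z$ to $X$. The body is smoothly uniform if it is uniform and each $X\in\mathcal B$ has a neighbourhood $U$ such that for every $Y\in U$ and every material isomorphism $g$ from $Y$ to $X$ there is a smooth field $P$ of material isomorphisms at $X$, defined on an open neighbourhood of $Y$, with $P(Y)=g$. A groupoid over $\mathcal B$ is transitive if its source and target maps together give a surjection onto $\mathcal B\times\mathcal B$. The subgroupoid $\Omega(\mathcal B)$ is an (immersed, respectively embedded) Lie subgroupoid of $\Pi^1(\mathcal B,\mathcal B)$ if its set of arrows carries the structure of a Hausdorff second countable smooth manifold for which the inclusion into $\Pi^1(\mathcal B,\mathcal B)$ is an immersion (respectively an embedding) and for which $\Omega(\mathcal B)$ is a Lie groupoid over $\mathcal B$, i.e. its source, target, identity, inversion and composition maps are smooth, and the source and target maps are submersions. Then $\mathcal B$ is smoothly uniform if and only if $\Omega(\mathcal B)$ is a transitive Lie subgroupoid of $\Pi^1(\mathcal B,\mathcal B)$.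 This equivalence holds both with "Lie subgroupoid" meaning immersed Lie subgroupoid and with it meaning embedded Lie subgroupoid. -/

import Mathlib

open scoped Manifold ContDiff Topology

noncomputable section

namespace Material

/-! ### Groupoids and Lie groupoids -/

/-- A groupoid over the set `M` with set of arrows `Γ`: source `src`, target `tgt`, identities `one`,
inversion `inv` and the composition `comp g h`, defined when the source of `g` is the target
of `h`. -/
structure GroupoidOver (Γ M : Type*) where
  src : Γ → M
  tgt : Γ → M
  one : M → Γ
  inv : Γ → Γ
  comp : ∀ g h : Γ, src g = tgt h → Γ
  src_one : ∀ x, src (one x) = x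
  tgt_one : ∀ x, tgt (one x) = x
  src_inv : ∀ g, src (inv g) = tgt g
  tgt_inv : ∀ g, tgt (inv g) = src g
  src_comp : ∀ g h e, src (comp g h e) = src h
  tgt_comp : ∀ g h e, tgt (comp g h e) = tgt g
  comp_assoc : ∀ g h k (e : src g = tgt h) (e' : src h = tgt k),
    comp g (comp h k e') (e.trans (tgt_comp h k e').symm) =
      comp (comp g h e) k ((src_comp g h e).trans e')
  comp_one : ∀ g, comp g (one (src g)) (tgt_one _).symm = g
  one_comp : ∀ g, comp (one (tgt g)) g (src_one _) = g
  inv_comp : ∀ g, comp (inv g) g (src_inv g) = one (src g)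
  comp_inv : ∀ g, comp g (inv g) (tgt_inv g).symm = one (tgt g)

/-- A groupoid is transitive when its anchor `(src, tgt) : Γ → M × M` is surjective. -/
def GroupoidOver.IsTransitive {Γ M : Type*} (G : GroupoidOver Γ M) : Prop :=
  Function.Surjective fun g => (G.src g, G.tgt g)

/-- The set of composable pairs. -/
def GroupoidOver.composable {Γ M : Type*} (G : GroupoidOver Γ M) : Set (Γ × Γ) :=
  {p | G.src p.1 = G.tgt p.2}

open Classical in
/-- The composition as a function on all pairs; its values outside `G.composable` are irrelevant. -/
def GroupoidOver.compFun {Γ M : Type*} (G : GroupoidOver Γ M) (p : Γ × Γ) : Γ :=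
  if h : G.src p.1 = G.tgt p.2 then G.comp p.1 p.2 h else p.1

/-- A groupoid whose arrows and objects form smooth manifolds is a Lie groupoid if all its structure
maps are smooth (the composition on the submanifold of composable pairs) and its source and
target maps are submersions. -/
structure GroupoidOver.IsLieGroupoid {E H E' H' : Type*}
    [NormedAddCommGroup E] [NormedSpace ℝ E] [TopologicalSpace H]
    [NormedAddCommGroup E'] [NormedSpace ℝ E'] [TopologicalSpace H']
    (I : ModelWithCorners ℝ E H) (J : ModelWithCorners ℝ E' H')
    {Γ M : Type*} [TopologicalSpace Γ] [ChartedSpace H Γ] [TopologicalSpace M] [ChartedSpace H' M]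
    (G : GroupoidOver Γ M) : Prop where
  isManifold_arrows : IsManifold I ∞ Γ
  isManifold_objects : IsManifold J ∞ M
  contMDiff_src : ContMDiff I J ∞ G.src
  contMDiff_tgt : ContMDiff I J ∞ G.tgt
  contMDiff_one : ContMDiff J I ∞ G.one
  contMDiff_inv : ContMDiff I I ∞ G.inv
  contMDiffOn_comp : ContMDiffOn (I.prod I) I ∞ G.compFun G.composable
  isSubmersion_src : ∀ g, Manifold.IsSubmersionAt I J ∞ G.src g
  isSubmersion_tgt : ∀ g, Manifold.IsSubmersionAt I J ∞ G.tgt g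

/-- A subgroupoid of `G` over the whole base `M`. -/
structure Subgroupoid {Γ M : Type*} (G : GroupoidOver Γ M) where
  carrier : Set Γ
  one_mem : ∀ x, G.one x ∈ carrier
  inv_mem : ∀ g ∈ carrier, G.inv g ∈ carrier
  comp_mem : ∀ g ∈ carrier, ∀ h ∈ carrier, ∀ e, G.comp g h e ∈ carrier

namespace Subgroupoid

variable {Γ M : Type*} {G : GroupoidOver Γ M}

/-- The arrows of a subgroupoid, as a type without a preferred topology. -/
def Arrow (S : Subgroupoid G) : Type _ := {g : Γ // g ∈ S.carrier}

/-- The inclusion map. -/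
def incl (S : Subgroupoid G) (g : S.Arrow) : Γ := g.1

/-- The restriction of the groupoid structure to a subgroupoid. -/
def toGroupoid (S : Subgroupoid G) : GroupoidOver S.Arrow M where
  src g := G.src g.1
  tgt g := G.tgt g.1
  one x := ⟨G.one x, S.one_mem x⟩
  inv g := ⟨G.inv g.1, S.inv_mem _ g.2⟩
  comp g h e := ⟨G.comp g.1 h.1 e, S.comp_mem _ g.2 _ h.2 e⟩
  src_one x := G.src_one x
  tgt_one x := G.tgt_one x
  src_inv g := G.src_inv g.1
  tgt_inv g := G.tgt_inv g.1
  src_comp g h e := G.src_comp g.1 h.1 e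
  tgt_comp g h e := G.tgt_comp g.1 h.1 e
  comp_assoc g h k e e' := Subtype.ext (G.comp_assoc g.1 h.1 k.1 e e')
  comp_one g := Subtype.ext (G.comp_one g.1)
  one_comp g := Subtype.ext (G.one_comp g.1)
  inv_comp g := Subtype.ext (G.inv_comp g.1)
  comp_inv g := Subtype.ext (G.comp_inv g.1)

variable {E H E' H' : Type*}
    [NormedAddCommGroup E] [NormedSpace ℝ E] [TopologicalSpace H]
    [NormedAddCommGroup E'] [NormedSpace ℝ E'] [TopologicalSpace H']
    [TopologicalSpace Γ] [ChartedSpace H Γ] [TopologicalSpace M] [ChartedSpace H' M]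

/-- `S` is a Lie subgroupoid (over `M`) of the Lie groupoid `G`, submanifolds being immersed ones:
the arrows of `S` carry the structure of a (Hausdorff, second countable) smooth manifold for which
the inclusion is an immersion and `S` is a Lie groupoid over `M`. -/
def IsLieSubgroupoid (I : ModelWithCorners ℝ E H) (J : ModelWithCorners ℝ E' H')
    (S : Subgroupoid G) : Prop :=
  ∃ (k : ℕ) (_ : TopologicalSpace S.Arrow) (_ : ChartedSpace (EuclideanSpace ℝ (Fin k)) S.Arrow),
    T2Space S.Arrow ∧ SecondCountableTopology S.Arrow ∧
    Manifold.IsImmersion (𝓡 k) I ∞ S.incl ∧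
    S.toGroupoid.IsLieGroupoid (𝓡 k) J

/-- `S` is an embedded Lie subgroupoid (over `M`) of the Lie groupoid `G`: the same, with the
inclusion a smooth embedding. -/
def IsEmbeddedLieSubgroupoid (I : ModelWithCorners ℝ E H) (J : ModelWithCorners ℝ E' H')
    (S : Subgroupoid G) : Prop :=
  ∃ (k : ℕ) (_ : TopologicalSpace S.Arrow) (_ : ChartedSpace (EuclideanSpace ℝ (Fin k)) S.Arrow),
    T2Space S.Arrow ∧ SecondCountableTopology S.Arrow ∧
    Manifold.IsSmoothEmbedding (𝓡 k) I ∞ S.incl ∧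
    S.toGroupoid.IsLieGroupoid (𝓡 k) J

end Subgroupoid

/-! ### Bodies and the 1-jets groupoid -/

/-- The Euclidean space `ℝ³`. -/
abbrev E3 : Type := EuclideanSpace ℝ (Fin 3)

/-- A body: a (nonempty) three-dimensional smooth manifold with a reference configuration, i.e. an embedding
into `ℝ³` (between manifolds of the same dimension: a diffeomorphism onto an open subset), which is
in particular a global chart. -/
class Body (B : Type*) [TopologicalSpace B] [ChartedSpace E3 B] where
  isManifold : IsManifold (𝓡 3) ∞ B
  nonempty : Nonempty B
  ref : B → E3
  isOpenEmbedding_ref : Topology.IsOpenEmbedding ref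
  contMDiff_ref : ContMDiff (𝓡 3) (𝓡 3) ∞ ref
  isInvertible_mfderiv_ref : ∀ X, (mfderiv (𝓡 3) (𝓡 3) ref X).IsInvertible

attribute [instance] Body.isManifold Body.nonempty

variable {B : Type*} [TopologicalSpace B] [ChartedSpace E3 B]

/-- The derivative at `X` of the reference configuration, as an isomorphism `T_X B ≃ ℝ³`. -/
def dref [Body B] (X : B) : TangentSpace (𝓡 3) X ≃L[ℝ] E3 :=
  (Body.isInvertible_mfderiv_ref X).choose

theorem coe_dref [Body B] (X : B) :
    (dref X : TangentSpace (𝓡 3) X →L[ℝ] E3) = mfderiv (𝓡 3) (𝓡 3) (Body.ref (B := B)) X :=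
  (Body.isInvertible_mfderiv_ref X).choose_spec

variable (B) in
/-- The set `Π¹(B, B)` of 1-jets of local diffeomorphisms of `B`, i.e. of all linear isomorphisms
`T_X B → T_Y B` with `X, Y ∈ B`. -/
structure Jet where
  src : B
  tgt : B
  map : TangentSpace (𝓡 3) src ≃L[ℝ] TangentSpace (𝓡 3) tgt

namespace Jet

/-- Composition of 1-jets. -/
def comp : ∀ g h : Jet B, g.src = h.tgt → Jet B
  | ⟨_, z, P⟩, ⟨x, _, Q⟩, rfl => ⟨x, z, Q.trans P⟩

/-- The identity of `T_X B`. -/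
def one (X : B) : Jet B := ⟨X, X, ContinuousLinearEquiv.refl ℝ _⟩

/-- The inverse 1-jet. -/
def inv (g : Jet B) : Jet B := ⟨g.tgt, g.src, g.map.symm⟩

theorem src_comp : ∀ (g h : Jet B) (e : g.src = h.tgt), (g.comp h e).src = h.src
  | ⟨_, _, _⟩, ⟨_, _, _⟩, rfl => rfl

theorem tgt_comp : ∀ (g h : Jet B) (e : g.src = h.tgt), (g.comp h e).tgt = g.tgt
  | ⟨_, _, _⟩, ⟨_, _, _⟩, rfl => rfl

theorem comp_assoc : ∀ (g h k : Jet B) (e : g.src = h.tgt) (e' : h.src = k.tgt),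
    g.comp (h.comp k e') (e.trans (tgt_comp h k e').symm) =
      (g.comp h e).comp k ((src_comp g h e).trans e')
  | ⟨_, _, _⟩, ⟨_, _, _⟩, ⟨_, _, _⟩, rfl, rfl => rfl

theorem inv_comp (g : Jet B) : g.inv.comp g rfl = one g.src := by
  obtain ⟨x, y, P⟩ := g
  exact congrArg (Jet.mk x x) (ContinuousLinearEquiv.self_trans_symm P)

theorem comp_inv (g : Jet B) : g.comp g.inv rfl = one g.tgt := by
  obtain ⟨x, y, P⟩ := g
  exact congrArg (Jet.mk y y) (ContinuousLinearEquiv.symm_trans_self P)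

/-- The model space of `Π¹(B, B)`. -/
abbrev Model : Type := E3 × E3 × (E3 →L[ℝ] E3)

/-- The global coordinates `(x^i, y^j, y^j_i)` on `Π¹(B, B)` induced by the reference configuration:
the coordinates of the source, those of the target, and the Jacobian matrix. -/
def coord [Body B] (g : Jet B) : Model :=
  (Body.ref g.src, Body.ref g.tgt,
    (((dref g.src).symm.trans (g.map.trans (dref g.tgt)) : E3 ≃L[ℝ] E3) : E3 →L[ℝ] E3))

variable [Body B]

theorem coord_injective : Function.Injective (coord (B := B)) := by
  rintro ⟨x, y, P⟩ ⟨x', y', Q⟩ h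
  simp only [coord, Prod.mk.injEq] at h
  obtain ⟨h1, h2, h3⟩ := h
  obtain rfl := Body.isOpenEmbedding_ref.injective h1
  obtain rfl := Body.isOpenEmbedding_ref.injective h2
  have h4 : P = Q := by
    ext1
    funext v
    have := DFunLike.congr_fun h3 (dref x v)
    simpa using this
  rw [h4]

theorem range_coord : Set.range (coord (B := B)) =
    Set.range (Body.ref (B := B)) ×ˢ Set.range (Body.ref (B := B)) ×ˢ
      Set.range ((↑) : (E3 ≃L[ℝ] E3) → (E3 →L[ℝ] E3)) := by
  ext ⟨a, b, A⟩
  constructor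
  · rintro ⟨g, hg⟩
    simp only [coord, Prod.mk.injEq] at hg
    exact ⟨⟨_, hg.1⟩, ⟨_, hg.2.1⟩, ⟨_, hg.2.2⟩⟩
  · rintro ⟨⟨x, rfl⟩, ⟨y, rfl⟩, ⟨A, rfl⟩⟩
    refine ⟨⟨x, y, (dref x).trans (A.trans (dref y).symm)⟩, ?_⟩
    simp only [coord, Prod.mk.injEq, true_and]
    ext1 v
    simp

/-- The topology of `Π¹(B, B)` for which the global coordinates are a homeomorphism onto the
image. -/
instance : TopologicalSpace (Jet B) := TopologicalSpace.induced coord inferInstance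

theorem isOpenEmbedding_coord : Topology.IsOpenEmbedding (coord (B := B)) where
  eq_induced := rfl
  injective := coord_injective
  isOpen_range := by
    rw [range_coord]
    exact Body.isOpenEmbedding_ref.isOpen_range.prod
      (Body.isOpenEmbedding_ref.isOpen_range.prod ContinuousLinearEquiv.isOpen)

instance : Nonempty (Jet B) := ⟨one (Classical.arbitrary B)⟩

/-- The smooth structure of `Π¹(B, B)`, given by the global coordinates. -/
instance : ChartedSpace Model (Jet B) := isOpenEmbedding_coord.singletonChartedSpace

instance : IsManifold 𝓘(ℝ, Model) ∞ (Jet B) :=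
  isOpenEmbedding_coord.isManifold_singleton

/-- The 1-jet at `Y` of `ref⁻¹ ∘ τ ∘ ref`, with `τ` the translation of `ℝ³` by the vector
`ref Z - ref Y`, so that `Y` is mapped to `Z`. -/
def translation (Y Z : B) : Jet B := ⟨Y, Z, (dref Y).trans (dref Z).symm⟩

end Jet

variable (B) in
/-- The 1-jets groupoid `Π¹(B, B)` over `B`. -/
def jetGroupoid : GroupoidOver (Jet B) B where
  src := Jet.src
  tgt := Jet.tgt
  one := Jet.one
  inv := Jet.inv
  comp := Jet.comp
  src_one _ := rfl
  tgt_one _ := rfl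
  src_inv _ := rfl
  tgt_inv _ := rfl
  src_comp := Jet.src_comp
  tgt_comp := Jet.tgt_comp
  comp_assoc := Jet.comp_assoc
  comp_one _ := rfl
  one_comp _ := rfl
  inv_comp := Jet.inv_comp
  comp_inv := Jet.comp_inv

/-! ### Mechanical responses and the material groupoid -/

section Response

variable {V : Type*}

/-- A mechanical response of the body `B`: a smooth map `W : Π¹(B, B) → V` which does not depend on
the final point, with respect to the reference configuration. -/
structure IsMechanicalResponse [NormedAddCommGroup V] [NormedSpace ℝ V] [Body B]
    (W : Jet B → V) : Prop where
  contMDiff : ContMDiff 𝓘(ℝ, Jet.Model) 𝓘(ℝ, V) ∞ W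
  comp_translation : ∀ (g : Jet B) (Z : B), W ((Jet.translation g.tgt Z).comp g rfl) = W g

/-- `g` is a material isomorphism: `W (k · g) = W k` for all 1-jets `k` starting where `g` ends. -/
def IsMaterialIso (W : Jet B → V) (g : Jet B) : Prop :=
  ∀ (k : Jet B) (e : k.src = g.tgt), W (k.comp g e) = W k

/-- The material groupoid `Ω(B)`: the subgroupoid of `Π¹(B, B)` of all material isomorphisms. -/
def materialGroupoid (W : Jet B → V) : Subgroupoid (jetGroupoid B) where
  carrier := {g | IsMaterialIso W g}
  one_mem := by
    rintro x ⟨y, z, P⟩ e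
    obtain rfl : y = x := e
    rfl
  inv_mem := by
    intro g hg k e
    change k.src = g.inv.tgt at e
    change W (k.comp g.inv e) = W k
    have h1 := hg (k.comp g.inv e) (Jet.src_comp _ _ _)
    rw [← Jet.comp_assoc k g.inv g e rfl] at h1
    rw [← h1]
    obtain ⟨x, y, P⟩ := g
    obtain ⟨x', y', Q⟩ := k
    cases e
    simp only [Jet.comp, Jet.inv]
    rw [ContinuousLinearEquiv.self_trans_symm]
    rfl
  comp_mem := by
    intro g hg h hh e k e'
    change k.src = (g.comp h e).tgt at e'
    have e'' : k.src = g.tgt := e'.trans (Jet.tgt_comp g h e)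
    have h1 := Jet.comp_assoc k g h e'' e
    change W (k.comp (g.comp h e) e') = W k
    rw [h1, hh _ _, hg _ _]

/-- The body with mechanical response `W` is uniform: any two points are joined by a material
isomorphism. -/
def IsUniform (W : Jet B → V) : Prop :=
  ∀ X Y : B, ∃ g : Jet B, IsMaterialIso W g ∧ g.src = X ∧ g.tgt = Y

/-- `P` is a smooth field of material isomorphisms at `X`, defined on the open set `U`: a smooth
local section on `U` of the source map restricted to the material isomorphisms with target `X`. -/
structure IsSmoothField [Body B] (W : Jet B → V) (X : B) (U : Set B) (P : B → Jet B) : Prop where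
  isOpen : IsOpen U
  contMDiffOn : ContMDiffOn (𝓡 3) 𝓘(ℝ, Jet.Model) ∞ P U
  isMaterialIso : ∀ Z ∈ U, IsMaterialIso W (P Z)
  src_eq : ∀ Z ∈ U, (P Z).src = Z
  tgt_eq : ∀ Z ∈ U, (P Z).tgt = X

/-- The body with mechanical response `W` is smoothly uniform: it is uniform, and each `X` has a
neighbourhood `U` such that every material isomorphism `g` from a point `Y ∈ U` to `X` is the value
at `Y` of a smooth field of material isomorphisms at `X`, defined around `Y`. -/
def IsSmoothlyUniform [Body B] (W : Jet B → V) : Prop :=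
  IsUniform W ∧ ∀ X : B, ∃ U ∈ 𝓝 X, ∀ Y ∈ U, ∀ g : Jet B,
    IsMaterialIso W g → g.src = Y → g.tgt = X →
      ∃ (U' : Set B) (P : B → Jet B), Y ∈ U' ∧ IsSmoothField W X U' P ∧ P Y = g

end Response

end Material

end

open Material

noncomputable section

namespace Material

/-! Smooth uniformity gives an embedded Lie subgroupoid. Fix a point X₀. Since `W` is continuous,
the isotropy group H of the material groupoid at X₀ is closed in GL(3), so by the closed subgroup
theorem (`exists_slice_of_isClosed`) the matrices near 1 have coordinates in h × m for which H is
the locus where the m-part vanishes. Around an arrow from x to y, smooth uniformity provides smooth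
fields p near x and q near y of material isomorphisms to X₀. A jet from a to b with matrix M is then
a material isomorphism iff q(b) M p(a)⁻¹ lies in H. So (a, b, q(b) M p(a)⁻¹) straightens the
material groupoid locally to a linear slice (`exists_sliceChart`). These slices give the manifold
structure; source and target are coordinate projections, hence submersions, and the other structure
maps are smooth because they are smooth in the ambient coordinates.

Conversely, let the material groupoid be a transitive Lie groupoid, immersed in the jets. Smooth
fields through an arrow are local sections of the source map inside a target fibre, so it suffices
that the source map be a submersion on target fibres. Its rank there is constant (`fibreRank_eq`):
left translations show that the rank depends only on the source of the arrow, inversion bounds it by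
the rank at the identity of the target, and transitivity compares all identities. If this rank is ρ,
the constant rank theorem and second countability make the image of a target fibre a countable union
of sets of Hausdorff dimension at most ρ. By transitivity this image is all of the three-dimensional
body, so ρ = 3 (`fibreRank_eq_finrank`), and local sections exist (`exists_local_section`).

Embedded Lie subgroupoids are immersed ones, so the two implications give both equivalences. -/

section

/-! ### Partial diffeomorphisms and the smooth inverse function theorem. -/

section SmoothHomeo

variable {E F G E' F' : Type*} [NormedAddCommGroup E] [NormedSpace ℝ E]
  [NormedAddCommGroup F] [NormedSpace ℝ F] [NormedAddCommGroup G] [NormedSpace ℝ G]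
  [NormedAddCommGroup E'] [NormedSpace ℝ E'] [NormedAddCommGroup F'] [NormedSpace ℝ F']

/-- An open partial homeomorphism between normed spaces is a partial diffeomorphism if it is smooth
together with its inverse. -/
structure IsPartialDiffeo (e : OpenPartialHomeomorph E F) : Prop where
  contDiffOn : ContDiffOn ℝ ∞ e e.source
  contDiffOn_symm : ContDiffOn ℝ ∞ e.symm e.target

namespace IsPartialDiffeo

theorem symm {e : OpenPartialHomeomorph E F} (h : IsPartialDiffeo e) : IsPartialDiffeo e.symm :=
  ⟨h.contDiffOn_symm, by simpa using h.contDiffOn⟩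

theorem trans {e : OpenPartialHomeomorph E F} {e' : OpenPartialHomeomorph F G}
    (h : IsPartialDiffeo e) (h' : IsPartialDiffeo e') : IsPartialDiffeo (e.trans e') := by
  constructor
  · refine h'.contDiffOn.comp (h.contDiffOn.mono ?_) ?_
    · exact fun x hx => hx.1
    · exact fun x hx => hx.2
  · refine h.contDiffOn_symm.comp (h'.contDiffOn_symm.mono ?_) ?_
    · exact fun x hx => hx.1
    · exact fun x hx => hx.2

theorem prod {e : OpenPartialHomeomorph E F} {e' : OpenPartialHomeomorph E' F'}
    (h : IsPartialDiffeo e) (h' : IsPartialDiffeo e') : IsPartialDiffeo (e.prod e') := by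
  constructor
  · exact h.contDiffOn.prodMap h'.contDiffOn
  · exact h.contDiffOn_symm.prodMap h'.contDiffOn_symm

theorem refl : IsPartialDiffeo (OpenPartialHomeomorph.refl E) :=
  ⟨contDiff_id.contDiffOn, contDiff_id.contDiffOn⟩

theorem of_continuousLinearEquiv (e : E ≃L[ℝ] F) :
    IsPartialDiffeo e.toHomeomorph.toOpenPartialHomeomorph :=
  ⟨e.contDiff.contDiffOn, e.symm.contDiff.contDiffOn⟩

end IsPartialDiffeo

/-- The inverse function theorem, for smooth functions on an open set. -/
theorem exists_isPartialDiffeo [CompleteSpace E] {f : E → F} {U : Set E} (hU : IsOpen U)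
    (hf : ContDiffOn ℝ ∞ f U) {a : E} (ha : a ∈ U) {f' : E ≃L[ℝ] F}
    (hf' : HasFDerivAt f (f' : E →L[ℝ] F) a) :
    ∃ e : OpenPartialHomeomorph E F, IsPartialDiffeo e ∧ a ∈ e.source ∧ e.source ⊆ U ∧
      ∀ x, e x = f x := by
  have hfa : ContDiffAt ℝ ∞ f a := hf.contDiffAt (hU.mem_nhds ha)
  let e₀ := hfa.toOpenPartialHomeomorph f hf' (by simp)
  have hc : ContinuousOn (fderiv ℝ f) U := hf.continuousOn_fderiv_of_isOpen hU (by simp)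
  -- Shrinking to the open set where the derivative is invertible makes the inverse smooth on the
  -- whole target, not just at the image of `a`.
  let U' : Set E := U ∩ fderiv ℝ f ⁻¹' Set.range ((↑) : (E ≃L[ℝ] F) → (E →L[ℝ] F))
  have hU' : IsOpen U' := hc.isOpen_inter_preimage hU ContinuousLinearEquiv.isOpen
  refine ⟨e₀.restrOpen U' hU', ⟨?_, ?_⟩, ?_, ?_, fun x => rfl⟩
  · exact hf.mono fun x hx => hx.2.1
  · rintro y ⟨hy, hy'⟩
    obtain ⟨h1, A, hA⟩ := hy'
    have h1 : e₀.symm y ∈ U := h1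
    have hA : (A : E →L[ℝ] F) = fderiv ℝ f (e₀.symm y) := hA
    have h2 : ContDiffAt ℝ ∞ f (e₀.symm y) := hf.contDiffAt (hU.mem_nhds h1)
    have h3 : HasFDerivAt f (A : E →L[ℝ] F) (e₀.symm y) := by
      rw [hA]; exact (h2.differentiableAt (by simp)).hasFDerivAt
    exact (e₀.contDiffAt_symm hy h3 h2).contDiffWithinAt
  · exact ⟨hfa.mem_toOpenPartialHomeomorph_source hf' _, ha, f', hf'.fderiv.symm⟩
  · exact fun x hx => hx.2.1

end SmoothHomeo

/-! ### The closed subgroup theorem for units of a Banach algebra. -/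

section ClosedSubgroup

open NormedSpace Filter

variable {R : Type*} [NormedRing R] [NormedAlgebra ℝ R] [CompleteSpace R]

theorem exp_add_of_commute' {x y : R} (h : Commute x y) : exp (x + y) = exp x * exp y :=
  have := NormedAlgebra.restrictScalars ℚ ℝ R
  exp_add_of_commute h

/-- The exponential, as a unit of the algebra. -/
def expUnit (a : R) : Rˣ where
  val := exp a
  inv := exp (-a)
  val_inv := by
    rw [← exp_add_of_commute' ((Commute.refl a).neg_right), add_neg_cancel, exp_zero]
  inv_val := by
    rw [← exp_add_of_commute' ((Commute.refl a).neg_left), neg_add_cancel, exp_zero]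

theorem contDiff_exp : ContDiff ℝ ∞ (exp : R → R) :=
  contDiff_iff_contDiffAt.2 fun x => (exp_analytic (𝕂 := ℝ) x).contDiffAt

theorem continuous_expUnit : Continuous (expUnit : R → Rˣ) := by
  rw [Units.continuous_iff]
  exact ⟨contDiff_exp.continuous, contDiff_exp.continuous.comp continuous_neg⟩

@[simp] theorem expUnit_zero : expUnit (0 : R) = 1 := Units.ext exp_zero

theorem expUnit_neg (a : R) : expUnit (-a) = (expUnit a)⁻¹ := Units.ext rfl

theorem expUnit_nsmul (n : ℕ) (a : R) : expUnit (n • a) = expUnit a ^ n := by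
  let := NormedAlgebra.restrictScalars ℚ ℝ R
  ext
  rw [Units.val_pow_eq_pow_val]
  exact exp_nsmul n a

theorem expUnit_zsmul (n : ℤ) (a : R) : expUnit (n • a) = expUnit a ^ n := by
  obtain ⟨n, rfl | rfl⟩ := n.eq_nat_or_neg
  · rw [natCast_zsmul, expUnit_nsmul, zpow_natCast]
  · rw [neg_smul, expUnit_neg, natCast_zsmul, expUnit_nsmul, zpow_neg, zpow_natCast]

/-- With nᵢ = ⌊t cᵢ⌋ one has nᵢ aᵢ → t b, as the fractional parts contribute at most ‖aᵢ‖ → 0.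
Moreover exp(nᵢ aᵢ) = exp(aᵢ)^nᵢ eventually lies in `H`, and `H` is closed. -/
theorem expUnit_smul_mem_of_tendsto {H : Subgroup Rˣ} (hH : IsClosed (H : Set Rˣ)) {ι : Type*}
    {l : Filter ι} [l.NeBot] {a : ι → R} {c : ι → ℝ} {b : R} (ha : Tendsto a l (𝓝 0))
    (haH : ∀ᶠ i in l, expUnit (a i) ∈ H) (hb : Tendsto (fun i => c i • a i) l (𝓝 b)) (t : ℝ) :
    expUnit (t • b) ∈ H := by
  have h1 : Tendsto (fun i => (⌊t * c i⌋ : ℤ) • a i) l (𝓝 (t • b)) := by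
    have h2 : Tendsto (fun i => t • (c i • a i) - Int.fract (t * c i) • a i) l
        (𝓝 (t • b - 0)) := by
      refine (hb.const_smul t).sub ?_
      rw [tendsto_zero_iff_norm_tendsto_zero] at ha ⊢
      refine squeeze_zero (fun _ => norm_nonneg _) (fun i => ?_) ha
      rw [norm_smul, Real.norm_of_nonneg (Int.fract_nonneg _)]
      exact mul_le_of_le_one_left (norm_nonneg _) (Int.fract_lt_one _).le
    rw [sub_zero] at h2
    refine h2.congr fun i => ?_
    rw [smul_smul, ← sub_smul, Int.self_sub_fract, Int.cast_smul_eq_zsmul]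
  refine hH.mem_of_tendsto ((continuous_expUnit.tendsto _).comp h1) ?_
  filter_upwards [haH] with i hi
  rw [Function.comp_apply, expUnit_zsmul]
  exact H.zpow_mem hi _

theorem exists_log : ∃ L : R → R, L 1 = 0 ∧ HasFDerivAt L (ContinuousLinearMap.id ℝ R) 1 ∧
    ∀ᶠ y in 𝓝 1, exp (L y) = y := by
  have h : HasStrictFDerivAt exp ((ContinuousLinearEquiv.refl ℝ R : R ≃L[ℝ] R) : R →L[ℝ] R) 0 :=
    hasStrictFDerivAt_exp_zero
  refine ⟨h.localInverse exp _ 0, ?_, ?_, ?_⟩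
  · simpa using h.localInverse_apply_image
  · simpa using h.to_localInverse.hasFDerivAt
  · simpa using h.eventually_right_inverse

/-- The logarithm of exp(s a) exp(s b) is s (a + b) + o(s). Divided by s it tends to a + b as s → 0,
so `expUnit_smul_mem_of_tendsto` applies with c = s⁻¹. -/
theorem expUnit_smul_add_mem {H : Subgroup Rˣ} (hH : IsClosed (H : Set Rˣ)) {a b : R}
    (ha : ∀ t : ℝ, expUnit (t • a) ∈ H) (hb : ∀ t : ℝ, expUnit (t • b) ∈ H) (t : ℝ) :
    expUnit (t • (a + b)) ∈ H := by
  obtain ⟨L, hL1, hL2, hL3⟩ := exists_log (R := R)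
  let f : ℝ → R := fun s => exp (s • a) * exp (s • b)
  have hf0 : f 0 = 1 := by simp [f]
  have hf : HasDerivAt f (a + b) 0 := by
    have h1 := (hasDerivAt_exp_smul_const (𝕂 := ℝ) a 0).mul
      (hasDerivAt_exp_smul_const (𝕂 := ℝ) b 0)
    simpa [Pi.mul_def] using h1
  have hg : HasDerivAt (fun s => L (f s)) (a + b) 0 := by
    have h2 : HasFDerivAt L (ContinuousLinearMap.id ℝ R) (f 0) := by rwa [hf0]
    simpa [Function.comp_def] using h2.comp_hasDerivAt 0 hf
  have hc : Tendsto f (𝓝[≠] 0) (𝓝 1) := by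
    rw [← hf0]; exact hf.continuousAt.tendsto.mono_left nhdsWithin_le_nhds
  refine expUnit_smul_mem_of_tendsto (l := 𝓝[≠] (0 : ℝ)) hH (a := fun s => L (f s))
    (c := fun s => s⁻¹) ?_ ?_ ?_ t
  · have := hg.continuousAt.tendsto.mono_left (nhdsWithin_le_nhds (s := {(0 : ℝ)}ᶜ))
    simpa [hf0, hL1] using this
  · filter_upwards [hc.eventually hL3] with s hs
    have : expUnit (L (f s)) = expUnit (s • a) * expUnit (s • b) := Units.ext hs
    rw [this]
    exact H.mul_mem (ha s) (hb s)
  · simpa [hf0, hL1] using hg.tendsto_slope_zero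

/-- The Lie algebra of a closed subgroup of the group of units of a Banach algebra. -/
def lieAlgebraOf (H : Subgroup Rˣ) (hH : IsClosed (H : Set Rˣ)) : Submodule ℝ R where
  carrier := {a | ∀ t : ℝ, expUnit (t • a) ∈ H}
  add_mem' ha hb := expUnit_smul_add_mem hH ha hb
  zero_mem' t := by simp
  smul_mem' c a ha t := by simpa [smul_smul] using ha (t * c)

/-- Otherwise there are nonzero bₙ → 0 in `m` with exp(bₙ) in `H`. A limit point of the unit vectors
bₙ/‖bₙ‖ lies in `m` and, by `expUnit_smul_mem_of_tendsto`, in the Lie algebra; being of norm 1, it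
contradicts disjointness. -/
theorem eventually_eq_zero_of_expUnit_mem [FiniteDimensional ℝ R] {H : Subgroup Rˣ}
    (hH : IsClosed (H : Set Rˣ)) {m : Submodule ℝ R} (hm : Disjoint (lieAlgebraOf H hH) m) :
    ∀ᶠ b : m in 𝓝 0, expUnit (b : R) ∈ H → b = 0 := by
  by_contra hcon
  obtain ⟨b, hb0, hb⟩ := exists_seq_forall_of_frequently (not_eventually.1 hcon)
  push Not at hb
  have hb0' : Tendsto (fun n => (b n : R)) atTop (𝓝 0) :=
    (continuous_subtype_val.tendsto' (0 : m) (0 : R) rfl).comp hb0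
  have hne : ∀ n, ‖(b n : R)‖ ≠ 0 := fun n => by simpa using (hb n).2
  have : ProperSpace R := FiniteDimensional.proper ℝ R
  obtain ⟨u, hu, φ, hφ, hlim⟩ := (isCompact_sphere (0 : R) 1).tendsto_subseq
    (x := fun n => ‖(b n : R)‖⁻¹ • (b n : R)) fun n => by
      rw [mem_sphere_zero_iff_norm, norm_smul, norm_inv, norm_norm, inv_mul_cancel₀ (hne n)]
  have h1 : u ∈ lieAlgebraOf H hH := fun t =>
    expUnit_smul_mem_of_tendsto hH (hb0'.comp hφ.tendsto_atTop)
      (Eventually.of_forall fun n => (hb _).1) hlim t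
  have h2 : u ∈ m := (Submodule.closed_of_finiteDimensional m).mem_of_tendsto hlim
    (Eventually.of_forall fun n => m.smul_mem _ (b _).2)
  have h3 : u = 0 := Submodule.disjoint_def.1 hm u h1 h2
  simp [h3] at hu

/-- The closed subgroup theorem: near `1`, a closed subgroup `H` of the group of units of a
finite-dimensional algebra is given by the vanishing of a part of suitable coordinates. -/
theorem exists_slice_of_isClosed [FiniteDimensional ℝ R] {H : Subgroup Rˣ}
    (hH : IsClosed (H : Set Rˣ)) :
    ∃ (h m : Submodule ℝ R) (_ : IsCompl h m) (e : OpenPartialHomeomorph R (h × m)),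
      IsPartialDiffeo e ∧ (1 : R) ∈ e.source ∧
      (∀ x ∈ e.source, IsUnit x) ∧ ∀ u : Rˣ, (u : R) ∈ e.source → (u ∈ H ↔ (e u).2 = 0) := by
  obtain ⟨m, hm⟩ := (lieAlgebraOf H hH).exists_isCompl
  set h := lieAlgebraOf H hH with hdef
  -- The first factor of exp x · exp y lies in `H`, so membership of the product is decided by exp y
  -- alone. The derivative at 0 is the sum map h × m → R, an isomorphism.
  let Φ : h × m → R := fun p => exp (p.1 : R) * exp (p.2 : R)
  have hΦ : ContDiff ℝ ∞ Φ :=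
    (contDiff_exp.comp (h.subtypeL.contDiff.comp contDiff_fst)).mul
      (contDiff_exp.comp (m.subtypeL.contDiff.comp contDiff_snd))
  let A : (h × m) ≃L[ℝ] R := (h.prodEquivOfIsCompl m hm).toContinuousLinearEquiv
  have hA : HasFDerivAt Φ (A : h × m →L[ℝ] R) 0 := by
    have h1 : HasFDerivAt (exp : R → R) (1 : R →L[ℝ] R) ((h.subtypeL.comp
        (ContinuousLinearMap.fst ℝ h m)) 0) := by simpa using hasFDerivAt_exp_zero
    have h2 : HasFDerivAt (exp : R → R) (1 : R →L[ℝ] R) ((m.subtypeL.comp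
        (ContinuousLinearMap.snd ℝ h m)) 0) := by simpa using hasFDerivAt_exp_zero
    have h3 := (h1.comp 0 (ContinuousLinearMap.hasFDerivAt _)).mul'
      (h2.comp 0 (ContinuousLinearMap.hasFDerivAt _))
    refine h3.congr_fderiv ?_
    ext x <;> simp [A]
  obtain ⟨N, hN, hNo, hN0⟩ := eventually_nhds_iff.1 (eventually_eq_zero_of_expUnit_mem hH hm.disjoint)
  have : CompleteSpace (h × m) := FiniteDimensional.complete ℝ _
  -- The m-component is kept in `N`, where exp y ∈ H forces y = 0.
  obtain ⟨e, he, he0, heU, heΦ⟩ := exists_isPartialDiffeo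
    (U := Prod.snd ⁻¹' N) (hNo.preimage continuous_snd) hΦ.contDiffOn (a := 0) hN0 (f' := A) hA
  have key : ∀ x ∈ e.target, x = exp ((e.symm x).1 : R) * exp ((e.symm x).2 : R) :=
    fun x hx => (e.right_inv hx).symm.trans (heΦ _)
  refine ⟨h, m, hm, e.symm, he.symm, ?_, ?_, ?_⟩
  · have := e.map_source he0
    rw [heΦ] at this
    simpa [Φ] using this
  · intro x hx
    rw [key x hx]
    exact (expUnit _ * expUnit _).isUnit
  · intro u hu
    have h1 : u = expUnit ((e.symm u).1 : R) * expUnit ((e.symm u).2 : R) := Units.ext (key u hu)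
    have h2 : expUnit ((e.symm u).1 : R) ∈ H := by simpa using (e.symm u).1.2 1
    have h3 : (e.symm u).2 ∈ N := heU (e.map_target hu)
    constructor
    · intro huH
      rw [h1, H.mul_mem_cancel_left h2] at huH
      exact hN _ h3 huH
    · intro h0
      rw [h1, h0]
      simpa using h2

end ClosedSubgroup

end

section

open Set

/-! ### Manifold structures defined by slice charts. -/

section Slice

variable {A E F C : Type*} [NormedAddCommGroup E] [NormedSpace ℝ E]
  [NormedAddCommGroup F] [NormedSpace ℝ F] [NormedAddCommGroup C] [NormedSpace ℝ C]

/-- A slice chart for (the range of) `j : A → E`: a partial diffeomorphism `E → F × C` which maps the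
points in the range of `j` to `F × 0`. -/
structure SliceChart (j : A → E) (F C : Type*) [NormedAddCommGroup F] [NormedSpace ℝ F]
    [NormedAddCommGroup C] [NormedSpace ℝ C] where
  toHomeo : OpenPartialHomeomorph E (F × C)
  isPartialDiffeo : IsPartialDiffeo toHomeo
  mem_range_iff : ∀ x ∈ toHomeo.source, x ∈ range j ↔ (toHomeo x).2 = 0

namespace SliceChart

variable {j : A → E} (s : SliceChart j F C)

theorem snd_apply {a : A} (ha : j a ∈ s.toHomeo.source) : (s.toHomeo (j a)).2 = 0 :=
  (s.mem_range_iff _ ha).1 ⟨a, rfl⟩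

theorem symm_mem_range {u : F} (hu : (u, (0 : C)) ∈ s.toHomeo.target) :
    s.toHomeo.symm (u, 0) ∈ range j := by
  rw [s.mem_range_iff _ (s.toHomeo.map_target hu), s.toHomeo.right_inv hu]

theorem mk_fst_apply {a : A} (ha : j a ∈ s.toHomeo.source) :
    ((s.toHomeo (j a)).1, (0 : C)) = s.toHomeo (j a) := Prod.ext rfl (s.snd_apply ha).symm

variable [TopologicalSpace A] [Nonempty A]

/-- The chart of `A` given by a slice chart. -/
def chart (hj : Topology.IsEmbedding j) : OpenPartialHomeomorph A F where
  toFun a := (s.toHomeo (j a)).1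
  -- On the target this is a genuine preimage, since points with vanishing `C`-component lie in the
  -- range of `j`; the default value of `Function.invFun` plays no role.
  invFun u := Function.invFun j (s.toHomeo.symm (u, 0))
  source := j ⁻¹' s.toHomeo.source
  target := {u | (u, (0 : C)) ∈ s.toHomeo.target}
  map_source' a ha := by
    simpa only [mem_ofPred_eq, s.mk_fst_apply ha] using s.toHomeo.map_source ha
  map_target' u hu := by
    rw [mem_preimage, Function.invFun_eq (s.symm_mem_range hu)]
    exact s.toHomeo.map_target hu
  left_inv' a ha := by
    rw [s.mk_fst_apply ha, s.toHomeo.left_inv ha, Function.leftInverse_invFun hj.injective a]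
  right_inv' u hu := by
    rw [Function.invFun_eq (s.symm_mem_range hu), s.toHomeo.right_inv hu]
  open_source := s.toHomeo.open_source.preimage hj.continuous
  open_target := s.toHomeo.open_target.preimage (by fun_prop)
  continuousOn_toFun := continuous_fst.comp_continuousOn
    (s.toHomeo.continuousOn.comp hj.continuous.continuousOn fun _ h => h)
  continuousOn_invFun := by
    rw [hj.continuousOn_iff]
    refine ContinuousOn.congr (f := fun u => s.toHomeo.symm (u, 0)) ?_ fun u hu =>
      Function.invFun_eq (s.symm_mem_range hu)
    exact s.toHomeo.continuousOn_symm.comp (by fun_prop) fun u hu => hu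

variable (hj : Topology.IsEmbedding j)

theorem apply_chart_symm {u : F} (hu : u ∈ (s.chart hj).target) :
    j ((s.chart hj).symm u) = s.toHomeo.symm (u, 0) :=
  Function.invFun_eq (s.symm_mem_range hu)

theorem contDiffOn_apply_chart_symm :
    ContDiffOn ℝ ∞ (fun u => j ((s.chart hj).symm u)) (s.chart hj).target := by
  refine ContDiffOn.congr (f := fun u => s.toHomeo.symm (u, 0)) ?_ fun u hu =>
    s.apply_chart_symm hj hu
  exact s.isPartialDiffeo.contDiffOn_symm.comp
    (contDiff_id.prodMk contDiff_const).contDiffOn fun u hu => hu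

end SliceChart

variable {j : A → E} [TopologicalSpace A] [Nonempty A]

/-- The manifold structure on `A` for which the charts come from slice charts for an embedding
of `A` into a normed space. -/
@[reducible] def chartedSpaceOfSlices (hj : Topology.IsEmbedding j)
    (h : ∀ a, ∃ s : SliceChart j F C, j a ∈ s.toHomeo.source) : ChartedSpace F A where
  atlas := range fun s : SliceChart j F C => s.chart hj
  chartAt a := (h a).choose.chart hj
  mem_chart_source a := (h a).choose_spec
  chart_mem_atlas _ := ⟨_, rfl⟩

variable (hj : Topology.IsEmbedding j) (h : ∀ a, ∃ s : SliceChart j F C, j a ∈ s.toHomeo.source)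

theorem isManifold_chartedSpaceOfSlices :
    letI := chartedSpaceOfSlices hj h
    IsManifold 𝓘(ℝ, F) ∞ A := by
  let := chartedSpaceOfSlices hj h
  refine isManifold_of_contDiffOn _ _ _ ?_
  rintro _ _ ⟨s, rfl⟩ ⟨s', rfl⟩
  simp only [modelWithCornersSelf_coe, modelWithCornersSelf_coe_symm, Function.comp_id,
    Function.id_comp, preimage_id, range_id, inter_univ]
  change ContDiffOn ℝ ∞ (fun u => (s'.toHomeo (j ((s.chart hj).symm u))).1) _
  refine contDiff_fst.comp_contDiffOn (s'.isPartialDiffeo.contDiffOn.comp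
    ((s.contDiffOn_apply_chart_symm hj).mono ?_) ?_)
  · exact fun u hu => hu.1
  · exact fun u hu => hu.2

theorem chart_mem_maximalAtlas (s : SliceChart j F C) :
    letI := chartedSpaceOfSlices hj h
    s.chart hj ∈ IsManifold.maximalAtlas 𝓘(ℝ, F) ∞ A := by
  let := chartedSpaceOfSlices hj h
  have := isManifold_chartedSpaceOfSlices hj h
  exact IsManifold.subset_maximalAtlas ⟨s, rfl⟩

/-- Continuity into `A` follows from the embedding, and each chart of `A` is the restriction along
`j` of a smooth map on an open subset of `E`. Thus smoothness into `A` can be tested in the ambient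
space. -/
theorem contMDiffWithinAt_of_comp_slices {E' H' M : Type*} [NormedAddCommGroup E']
    [NormedSpace ℝ E'] [TopologicalSpace H'] {I' : ModelWithCorners ℝ E' H'} [TopologicalSpace M]
    [ChartedSpace H' M] {f : M → A} {t : Set M} {x : M}
    (hf : ContMDiffWithinAt I' 𝓘(ℝ, E) ∞ (fun y => j (f y)) t x) :
    letI := chartedSpaceOfSlices hj h
    ContMDiffWithinAt I' 𝓘(ℝ, F) ∞ f t x := by
  let := chartedSpaceOfSlices hj h
  have := isManifold_chartedSpaceOfSlices hj h
  obtain ⟨s, hs⟩ := h (f x)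
  have hc : ContinuousWithinAt f t x := hj.continuousWithinAt_iff.2 hf.continuousWithinAt
  rw [contMDiffWithinAt_iff_target_of_mem_maximalAtlas (chart_mem_maximalAtlas hj h s) hs]
  refine ⟨hc, ?_⟩
  have h1 : ContMDiffAt 𝓘(ℝ, E) 𝓘(ℝ, F) ∞ (fun x => (s.toHomeo x).1) (j (f x)) :=
    (s.isPartialDiffeo.contDiffOn.contDiffAt (s.toHomeo.open_source.mem_nhds hs)).fst.contMDiffAt
  exact ContMDiffAt.comp_contMDiffWithinAt (f := fun y => j (f y)) x h1 hf

variable {N : Type*} [TopologicalSpace N] [ChartedSpace E N] [IsManifold 𝓘(ℝ, E) ∞ N]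
  {ψ : OpenPartialHomeomorph N E} {ι : A → N}

/-- Following the global chart `ψ` by a slice chart and `L` gives a chart of `N` in which `ι` is u ↦
L (u, 0). -/
theorem isImmersion_of_slices
    (hψ : ψ ∈ IsManifold.maximalAtlas 𝓘(ℝ, E) ∞ N) (hψu : ψ.source = univ)
    (hι : ∀ a, ψ (ι a) = j a) (L : (F × C) ≃L[ℝ] E) :
    letI := chartedSpaceOfSlices hj h
    Manifold.IsImmersionOfComplement C 𝓘(ℝ, F) 𝓘(ℝ, E) ∞ ι := by
  let := chartedSpaceOfSlices hj h
  have := isManifold_chartedSpaceOfSlices hj h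
  intro a
  obtain ⟨s, hs⟩ := h a
  let e : OpenPartialHomeomorph E E := s.toHomeo.trans L.toHomeomorph.toOpenPartialHomeomorph
  have he : IsPartialDiffeo e :=
    s.isPartialDiffeo.trans (IsPartialDiffeo.of_continuousLinearEquiv L)
  refine Manifold.IsImmersionAtOfComplement.mk_of_charts L (s.chart hj) (ψ.trans e) hs ?_
    (chart_mem_maximalAtlas hj h s) ?_ ?_ ?_
  · simpa [e, hψu, hι] using hs
  · refine OpenPartialHomeomorph.mem_maximalAtlas_of_contMDiffOn _ ?_ ?_
    · exact ContMDiffOn.comp (g := e) (t := e.source) he.contDiffOn.contMDiffOn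
        ((contMDiffOn_of_mem_maximalAtlas hψ).mono fun x hx => hx.1) fun x hx => hx.2
    · exact ContMDiffOn.comp (g := ψ.symm) (t := ψ.target) (contMDiffOn_symm_of_mem_maximalAtlas hψ)
        (he.contDiffOn_symm.contMDiffOn.mono fun x hx => hx.1) fun x hx => hx.2
  · intro b hb
    have hb : j b ∈ s.toHomeo.source := hb
    simpa [e, hψu, hι] using hb
  · intro u hu
    have hu : u ∈ (s.chart hj).target := by simpa using hu
    have h2 : ψ (ι ((s.chart hj).symm u)) = s.toHomeo.symm (u, 0) := by
      rw [hι, s.apply_chart_symm hj hu]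
    have h3 : s.toHomeo (s.toHomeo.symm (u, 0)) = (u, 0) := s.toHomeo.right_inv hu
    simp [e, h2, h3]

/-- By `hf`, in the charts of `s` and `ψ'` and after `L`, the map is the projection E' × G → E'. -/
theorem isSubmersionAt_of_slices {E' G N' : Type*} [NormedAddCommGroup E'] [NormedSpace ℝ E']
    [NormedAddCommGroup G] [NormedSpace ℝ G] [TopologicalSpace N'] [ChartedSpace E' N']
    {ψ' : OpenPartialHomeomorph N' E'} (hψ' : ψ' ∈ IsManifold.maximalAtlas 𝓘(ℝ, E') ∞ N')
    (hψu' : ψ'.source = univ) {f : A → N'} (s : SliceChart j F C) (L : F ≃L[ℝ] (E' × G))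
    (hf : ∀ b, j b ∈ s.toHomeo.source → ψ' (f b) = (L (s.toHomeo (j b)).1).1) {a : A}
    (ha : j a ∈ s.toHomeo.source) :
    letI := chartedSpaceOfSlices hj h
    Manifold.IsSubmersionAt 𝓘(ℝ, F) 𝓘(ℝ, E') ∞ f a := by
  let := chartedSpaceOfSlices hj h
  refine Manifold.IsSubmersionAt.mk_of_charts L (s.chart hj) ψ' ha (hψu' ▸ mem_univ _)
    (chart_mem_maximalAtlas hj h s) hψ' (fun _ _ => by simp [hψu']) ?_
  intro u hu
  have hu : u ∈ (s.chart hj).target := by simpa using hu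
  have h1 := hf _ ((s.chart hj).map_target hu)
  have h2 : (s.toHomeo (j ((s.chart hj).symm u))).1 = u := (s.chart hj).right_inv hu
  rw [h2] at h1
  simpa using h1

end Slice

end

section

open Set

/-! ### Smoothness tested in a global chart. -/

section GlobalChart

variable {E E' H' M N : Type*} [NormedAddCommGroup E] [NormedSpace ℝ E] [NormedAddCommGroup E']
  [NormedSpace ℝ E'] [TopologicalSpace H'] {I' : ModelWithCorners ℝ E' H'}
  [TopologicalSpace M] [ChartedSpace H' M] [TopologicalSpace N] [ChartedSpace E N]
  {ψ : OpenPartialHomeomorph N E}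

theorem contMDiff_of_mem_maximalAtlas (hψ : ψ ∈ IsManifold.maximalAtlas 𝓘(ℝ, E) ∞ N)
    (hψu : ψ.source = univ) : ContMDiff 𝓘(ℝ, E) 𝓘(ℝ, E) ∞ ψ := by
  rw [← contMDiffOn_univ, ← hψu]
  exact contMDiffOn_of_mem_maximalAtlas hψ

theorem contMDiffWithinAt_iff_comp_chart [IsManifold 𝓘(ℝ, E) ∞ N]
    (hψ : ψ ∈ IsManifold.maximalAtlas 𝓘(ℝ, E) ∞ N)
    (hψu : ψ.source = univ) {f : M → N} {s : Set M} {x : M} :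
    ContMDiffWithinAt I' 𝓘(ℝ, E) ∞ f s x ↔
      ContMDiffWithinAt I' 𝓘(ℝ, E) ∞ (fun y => ψ (f y)) s x := by
  constructor
  · exact fun h => ContMDiffAt.comp_contMDiffWithinAt x
      (contMDiff_of_mem_maximalAtlas hψ hψu).contMDiffAt h
  · intro h
    have h1 : ContMDiffAt 𝓘(ℝ, E) 𝓘(ℝ, E) ∞ ψ.symm (ψ (f x)) :=
      contMDiffAt_symm_of_mem_maximalAtlas hψ (ψ.map_source (by simp [hψu]))
    have h2 := ContMDiffAt.comp_contMDiffWithinAt (f := fun y => ψ (f y)) x h1 h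
    have h3 : ψ.symm ∘ (fun y => ψ (f y)) = f := by
      funext y
      exact ψ.left_inv (by simp [hψu])
    rwa [h3] at h2

end GlobalChart

/-! ### Global coordinates on the body and on its 1-jets. -/

section Body

variable {B : Type*} [TopologicalSpace B] [ChartedSpace E3 B] [Body B]

variable (B) in
/-- The reference configuration as a global chart. -/
def refHomeo : OpenPartialHomeomorph B E3 :=
  (Body.isOpenEmbedding_ref (B := B)).toOpenPartialHomeomorph Body.ref

@[simp] theorem refHomeo_apply (X : B) : refHomeo B X = Body.ref X := rfl

@[simp] theorem refHomeo_source : (refHomeo B).source = univ := rfl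

@[simp] theorem refHomeo_target : (refHomeo B).target = range (Body.ref (B := B)) := by
  simp [refHomeo]

@[simp] theorem refHomeo_symm_ref (X : B) : (refHomeo B).symm (Body.ref X) = X :=
  (refHomeo B).left_inv (mem_univ X)

/-- In a chart `φ` at `X`, the derivative of the reference configuration is its `mfderiv`, which is
invertible by assumption; the inverse of `e` is therefore smooth at the image point, and so is its
composite with `φ.symm`. -/
theorem contMDiffAt_refHomeo_symm (X : B) :
    ContMDiffAt (𝓡 3) (𝓡 3) ∞ (refHomeo B).symm (Body.ref X) := by
  let φ := chartAt E3 X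
  let e : OpenPartialHomeomorph E3 E3 := φ.symm.trans (refHomeo B)
  have hφX : φ X ∈ φ.target := mem_chart_target E3 X
  have hX : φ X ∈ e.source := by simp [e, hφX]
  have he : ContDiffAt ℝ ∞ e (φ X) := by
    have h1 : ContMDiffAt (𝓡 3) (𝓡 3) ∞ φ.symm (φ X) :=
      contMDiffAt_symm_of_mem_maximalAtlas (IsManifold.chart_mem_maximalAtlas X) hφX
    exact ((Body.contMDiff_ref (B := B) _).comp _ h1).contDiffAt
  obtain ⟨A, hA⟩ := Body.isInvertible_mfderiv_ref X
  let A' : E3 ≃L[ℝ] E3 := A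
  have hd : HasFDerivAt e (A' : E3 →L[ℝ] E3) (φ X) := by
    have h1 := ((Body.contMDiff_ref (B := B) X).mdifferentiableAt (by simp)).hasMFDerivAt.2
    rw [← hA] at h1
    simp only [mfld_simps] at h1
    exact hasFDerivWithinAt_univ.1 h1
  have h2 : e (φ X) = Body.ref X := by simp [e, φ]
  have h3 : e.symm (Body.ref X) = φ X := by rw [← h2, e.left_inv hX]
  have h4 : ContDiffAt ℝ ∞ e.symm (Body.ref X) := by
    refine e.contDiffAt_symm (f₀' := A') ?_ ?_ ?_
    · rw [← h2]; exact e.map_source hX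
    · rwa [h3]
    · rwa [h3]
  have h5 : ContMDiffAt (𝓡 3) (𝓡 3) ∞ φ.symm (e.symm (Body.ref X)) := by
    rw [h3]
    exact contMDiffAt_symm_of_mem_maximalAtlas (IsManifold.chart_mem_maximalAtlas X) hφX
  refine (h5.comp _ h4.contMDiffAt).congr_of_eventuallyEq ?_
  have h6 : Body.ref X ∈ e.target := by rw [← h2]; exact e.map_source hX
  filter_upwards [e.open_target.mem_nhds h6] with y hy
  have h7 : (refHomeo B).symm y ∈ φ.source := by simpa [e] using hy.2
  simp [e, φ.left_inv h7]

theorem refHomeo_mem_maximalAtlas : refHomeo B ∈ IsManifold.maximalAtlas (𝓡 3) ∞ B := by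
  refine OpenPartialHomeomorph.mem_maximalAtlas_of_contMDiffOn _
    Body.contMDiff_ref.contMDiffOn fun y hy => ?_
  rw [refHomeo_target] at hy
  obtain ⟨X, rfl⟩ := hy
  exact (contMDiffAt_refHomeo_symm X).contMDiffWithinAt

variable (B) in
/-- The global coordinates on the 1-jets groupoid as a chart. -/
def coordHomeo : OpenPartialHomeomorph (Jet B) Jet.Model :=
  (Jet.isOpenEmbedding_coord (B := B)).toOpenPartialHomeomorph Jet.coord

theorem coordHomeo_source : (coordHomeo B).source = univ := rfl

theorem coordHomeo_mem_maximalAtlas :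
    coordHomeo B ∈ IsManifold.maximalAtlas 𝓘(ℝ, Jet.Model) ∞ (Jet B) :=
  IsManifold.subset_maximalAtlas (Set.mem_singleton _)

section Smooth

variable {E' H' M : Type*} [NormedAddCommGroup E'] [NormedSpace ℝ E'] [TopologicalSpace H']
  {I' : ModelWithCorners ℝ E' H'} [TopologicalSpace M] [ChartedSpace H' M] {s : Set M} {x : M}

theorem contMDiffWithinAt_iff_ref {f : M → B} :
    ContMDiffWithinAt I' (𝓡 3) ∞ f s x ↔
      ContMDiffWithinAt I' (𝓡 3) ∞ (fun y => Body.ref (f y)) s x :=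
  contMDiffWithinAt_iff_comp_chart refHomeo_mem_maximalAtlas refHomeo_source

end Smooth

theorem contMDiff_coord : ContMDiff 𝓘(ℝ, Jet.Model) 𝓘(ℝ, Jet.Model) ∞ (Jet.coord (B := B)) :=
  contMDiff_of_mem_maximalAtlas coordHomeo_mem_maximalAtlas coordHomeo_source

namespace Jet

/-- The 1-jet with source `x`, target `y` and Jacobian matrix `u`. -/
def ofMatrix (x y : B) (u : (E3 →L[ℝ] E3)ˣ) : Jet B :=
  ⟨x, y, (dref x).trans ((ContinuousLinearEquiv.ofUnit u).trans (dref y).symm)⟩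

@[simp] theorem coord_ofMatrix (x y : B) (u : (E3 →L[ℝ] E3)ˣ) :
    (ofMatrix x y u).coord = (Body.ref x, Body.ref y, (u : E3 →L[ℝ] E3)) := by
  simp only [coord, ofMatrix, Prod.mk.injEq, true_and]
  refine ContinuousLinearMap.ext fun v => ?_
  change dref y ((dref y).symm ((u : E3 →L[ℝ] E3) (dref x ((dref x).symm v)))) = _
  rw [ContinuousLinearEquiv.apply_symm_apply, ContinuousLinearEquiv.apply_symm_apply]

/-- The Jacobian matrix of a 1-jet. -/
def matrix (g : Jet B) : (E3 →L[ℝ] E3)ˣ :=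
  ((dref g.src).symm.trans (g.map.trans (dref g.tgt)) : E3 ≃L[ℝ] E3).toUnit

theorem coord_eq (g : Jet B) : g.coord = (Body.ref g.src, Body.ref g.tgt, (g.matrix : E3 →L[ℝ] E3)) :=
  rfl

theorem ofMatrix_matrix (g : Jet B) : ofMatrix g.src g.tgt g.matrix = g :=
  coord_injective (by rw [coord_ofMatrix, coord_eq])

theorem exists_eq_ofMatrix (g : Jet B) : ∃ u, g = ofMatrix g.src g.tgt u :=
  ⟨_, g.ofMatrix_matrix.symm⟩

theorem comp_ofMatrix (x y z : B) (u v : (E3 →L[ℝ] E3)ˣ) :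
    (ofMatrix y z u).comp (ofMatrix x y v) rfl = ofMatrix x z (u * v) := by
  refine congrArg (Jet.mk x z) (ContinuousLinearEquiv.ext (funext fun w => ?_))
  change (dref z).symm (u.1 (dref y ((dref y).symm (v.1 (dref x w))))) = _
  rw [ContinuousLinearEquiv.apply_symm_apply]
  rfl

theorem one_eq_ofMatrix (x : B) : one x = ofMatrix x x 1 := by
  refine congrArg (Jet.mk x x) (ContinuousLinearEquiv.ext (funext fun w => ?_))
  exact ((dref x).symm_apply_apply w).symm

theorem inv_ofMatrix (x y : B) (u : (E3 →L[ℝ] E3)ˣ) : (ofMatrix x y u).inv = ofMatrix y x u⁻¹ := rfl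

theorem coord_comp (g h : Jet B) (e : g.src = h.tgt) : (g.comp h e).coord =
    (h.coord.1, g.coord.2.1, g.coord.2.2 * h.coord.2.2) := by
  obtain ⟨x, z, u⟩ := g
  obtain ⟨y, x', v⟩ := h
  obtain rfl : x = x' := e
  obtain ⟨u, hu⟩ := exists_eq_ofMatrix ⟨x, z, u⟩
  obtain ⟨v, hv⟩ := exists_eq_ofMatrix ⟨y, x, v⟩
  simp only at hu hv
  simp only [hu, hv, comp_ofMatrix, coord_ofMatrix, Units.val_mul]

theorem coord_inv (g : Jet B) : g.inv.coord =
    (g.coord.2.1, g.coord.1, Ring.inverse g.coord.2.2) := by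
  obtain ⟨u, hu⟩ := g.exists_eq_ofMatrix
  rw [hu, inv_ofMatrix]
  simp

theorem coord_one (x : B) : (one x).coord = (Body.ref x, Body.ref x, 1) := by
  rw [one_eq_ofMatrix, coord_ofMatrix, Units.val_one]

theorem continuous_ofMatrix (x y : B) : Continuous (ofMatrix x y) := by
  rw [isOpenEmbedding_coord.isInducing.continuous_iff]
  have : coord ∘ ofMatrix x y = fun u : (E3 →L[ℝ] E3)ˣ => (Body.ref x, Body.ref y, (u : E3 →L[ℝ] E3)) :=
    funext (coord_ofMatrix x y)
  rw [this]
  exact continuous_const.prodMk (continuous_const.prodMk Units.continuous_val)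

end Jet

end Body

end

section

open Set

/-! ### Isotropy groups of the material groupoid. -/

section Isotropy

variable {B : Type*} [TopologicalSpace B] [ChartedSpace E3 B] [Body B]
  {V : Type*} {W : Jet B → V}

theorem isMaterialIso_ofMatrix_iff {x y : B} {u : (E3 →L[ℝ] E3)ˣ} :
    IsMaterialIso W (Jet.ofMatrix x y u) ↔
      ∀ (z : B) (k : (E3 →L[ℝ] E3)ˣ), W (Jet.ofMatrix x z (k * u)) = W (Jet.ofMatrix y z k) := by
  constructor
  · intro h z k
    rw [← Jet.comp_ofMatrix x y z]
    exact h (Jet.ofMatrix y z k) rfl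
  · intro h k e
    obtain ⟨a, b, v, rfl⟩ : ∃ a b v, k = Jet.ofMatrix a b v := ⟨_, _, k.exists_eq_ofMatrix⟩
    obtain rfl : a = y := e
    rw [Jet.comp_ofMatrix, h]

theorem isMaterialIso_mul {x y z : B} {u v : (E3 →L[ℝ] E3)ˣ}
    (hu : IsMaterialIso W (Jet.ofMatrix y z u)) (hv : IsMaterialIso W (Jet.ofMatrix x y v)) :
    IsMaterialIso W (Jet.ofMatrix x z (u * v)) := by
  rw [← Jet.comp_ofMatrix x y z]
  exact (materialGroupoid W).comp_mem _ hu _ hv rfl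

theorem isMaterialIso_inv {x y : B} {u : (E3 →L[ℝ] E3)ˣ}
    (hu : IsMaterialIso W (Jet.ofMatrix x y u)) : IsMaterialIso W (Jet.ofMatrix y x u⁻¹) :=
  (materialGroupoid W).inv_mem _ hu

variable (W) in
/-- The isotropy group of the material groupoid at `x`, as a group of matrices. -/
def isotropy (x : B) : Subgroup (E3 →L[ℝ] E3)ˣ where
  carrier := {u | IsMaterialIso W (Jet.ofMatrix x x u)}
  mul_mem' hu hv := isMaterialIso_mul hu hv
  one_mem' := by
    rw [mem_ofPred_eq, ← Jet.one_eq_ofMatrix]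
    exact (materialGroupoid W).one_mem x
  inv_mem' hu := isMaterialIso_inv hu

theorem mem_isotropy {x : B} {u : (E3 →L[ℝ] E3)ˣ} :
    u ∈ isotropy W x ↔ IsMaterialIso W (Jet.ofMatrix x x u) := Iff.rfl

/-- For each jet `k` starting at `x`, the condition W(k u) = W(k) is closed in u; the isotropy group
is the intersection of these conditions. -/
theorem isClosed_isotropy [TopologicalSpace V] [T2Space V] (hW : Continuous W) (x : B) :
    IsClosed (isotropy W x : Set (E3 →L[ℝ] E3)ˣ) := by
  have : (isotropy W x : Set (E3 →L[ℝ] E3)ˣ) = ⋂ (z : B) (k : (E3 →L[ℝ] E3)ˣ),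
      {u | W (Jet.ofMatrix x z (k * u)) = W (Jet.ofMatrix x z k)} := by
    ext u
    simp only [mem_iInter, mem_ofPred_eq, SetLike.mem_coe, mem_isotropy, isMaterialIso_ofMatrix_iff]
  rw [this]
  refine isClosed_iInter fun z => isClosed_iInter fun k => isClosed_eq ?_ continuous_const
  exact hW.comp ((Jet.continuous_ofMatrix x z).comp (continuous_const.mul continuous_id))

end Isotropy

/-! ### Matrix fields and slice charts of the material groupoid. -/

section Fields

variable {B : Type*} [TopologicalSpace B] [ChartedSpace E3 B] [Body B]
  {V : Type*} {W : Jet B → V}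

/-- `p` is the matrix of a smooth field of material isomorphisms with target `X₀`, in the
coordinates given by the reference configuration. -/
structure IsMatrixField (W : Jet B → V) (X₀ : B) (U : Set E3) (p : E3 → E3 →L[ℝ] E3) : Prop where
  isOpen : IsOpen U
  contDiffOn : ContDiffOn ℝ ∞ p U
  exists_eq : ∀ a ∈ U, ∃ (Z : B) (u : (E3 →L[ℝ] E3)ˣ),
    Body.ref Z = a ∧ p a = u ∧ IsMaterialIso W (Jet.ofMatrix Z X₀ u)

theorem IsMatrixField.isUnit {X₀ : B} {U : Set E3} {p : E3 → E3 →L[ℝ] E3}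
    (h : IsMatrixField W X₀ U p) {a : E3} (ha : a ∈ U) : IsUnit (p a) := by
  obtain ⟨_, u, _, hu, _⟩ := h.exists_eq a ha
  exact hu ▸ u.isUnit

/-- Smooth uniformity is applied at `Y` to the identity of `Y`, giving a smooth field with target
`Y` and value 1 there. Multiplying it on the left by the constant `u` moves the target to X₀ and the
value at `Y` to `u`. -/
theorem IsSmoothlyUniform.exists_isMatrixField (hW : IsSmoothlyUniform W) {X₀ Y : B}
    {u : (E3 →L[ℝ] E3)ˣ} (hu : IsMaterialIso W (Jet.ofMatrix Y X₀ u)) :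
    ∃ (U : Set E3) (p : E3 → E3 →L[ℝ] E3), IsMatrixField W X₀ U p ∧ Body.ref Y ∈ U ∧
      p (Body.ref Y) = u := by
  obtain ⟨U, hU, h⟩ := hW.2 Y
  obtain ⟨U', P, hY, hP, hPY⟩ := h Y (mem_of_mem_nhds hU) (Jet.one Y)
    ((materialGroupoid W).one_mem Y) rfl rfl
  refine ⟨Body.ref '' U', fun a => u * (P ((refHomeo B).symm a)).coord.2.2,
    ⟨Body.isOpenEmbedding_ref.isOpenMap _ hP.isOpen, ?_, ?_⟩, mem_image_of_mem _ hY, ?_⟩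
  · have h1 : ContMDiffOn (𝓡 3) 𝓘(ℝ, Jet.Model) ∞ (fun a => (P ((refHomeo B).symm a)).coord)
        (Body.ref '' U') := by
      refine contMDiff_coord.comp_contMDiffOn (hP.contMDiffOn.comp
        ((contMDiffOn_symm_of_mem_maximalAtlas refHomeo_mem_maximalAtlas).mono ?_) ?_)
      · rw [refHomeo_target]
        exact image_subset_range _ _
      · rintro _ ⟨Z, hZ, rfl⟩
        simpa using hZ
    exact contDiffOn_const.mul h1.contDiffOn.snd.snd
  · rintro _ ⟨Z, hZ, rfl⟩
    obtain ⟨v, hv⟩ := (P Z).exists_eq_ofMatrix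
    rw [hP.src_eq Z hZ, hP.tgt_eq Z hZ] at hv
    refine ⟨Z, u * v, rfl, ?_, isMaterialIso_mul hu (hv ▸ hP.isMaterialIso Z hZ)⟩
    simp [hv]
  · simp [hPY, Jet.coord_one]

theorem contDiffOn_ringInverse {U : Set E3} {p : E3 → E3 →L[ℝ] E3} (hp : ContDiffOn ℝ ∞ p U)
    (hpu : ∀ a ∈ U, IsUnit (p a)) : ContDiffOn ℝ ∞ (fun a => Ring.inverse (p a)) U := by
  intro a ha
  obtain ⟨u, hu⟩ := hpu a ha
  have h1 : ContDiffAt ℝ ∞ Ring.inverse (p a) := hu ▸ contDiffAt_ringInverse ℝ u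
  exact h1.comp_contDiffWithinAt a (hp a ha)

theorem contDiffOn_mul_fields {U U' : Set E3} {f g : E3 → E3 →L[ℝ] E3}
    (hf : ContDiffOn ℝ ∞ f U') (hg : ContDiffOn ℝ ∞ g U) :
    ContDiffOn ℝ ∞ (fun x : Jet.Model => ((x.1, x.2.1, f x.2.1 * x.2.2 * g x.1) : Jet.Model))
      {x | x.1 ∈ U ∧ x.2.1 ∈ U'} := by
  have h1 : ContDiffOn ℝ ∞ (fun x : Jet.Model => f x.2.1) {x | x.1 ∈ U ∧ x.2.1 ∈ U'} :=
    hf.comp contDiff_snd.fst.contDiffOn fun x hx => hx.2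
  have h2 : ContDiffOn ℝ ∞ (fun x : Jet.Model => g x.1) {x | x.1 ∈ U ∧ x.2.1 ∈ U'} :=
    hg.comp contDiff_fst.contDiffOn fun x hx => hx.1
  exact contDiff_fst.contDiffOn.prodMk (contDiff_snd.fst.contDiffOn.prodMk
    ((h1.mul contDiff_snd.snd.contDiffOn).mul h2))

/-- Multiplication of matrices by fields of matrices depending on the source and the target. -/
def fieldHomeo {U U' : Set E3} {p q : E3 → E3 →L[ℝ] E3} (hU : IsOpen U) (hU' : IsOpen U')
    (hp : ContDiffOn ℝ ∞ p U) (hq : ContDiffOn ℝ ∞ q U') (hpu : ∀ a ∈ U, IsUnit (p a))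
    (hqu : ∀ a ∈ U', IsUnit (q a)) : OpenPartialHomeomorph Jet.Model Jet.Model where
  toFun x := (x.1, x.2.1, q x.2.1 * x.2.2 * Ring.inverse (p x.1))
  invFun x := (x.1, x.2.1, Ring.inverse (q x.2.1) * x.2.2 * p x.1)
  source := {x | x.1 ∈ U ∧ x.2.1 ∈ U'}
  target := {x | x.1 ∈ U ∧ x.2.1 ∈ U'}
  map_source' _ h := h
  map_target' _ h := h
  left_inv' := by
    rintro ⟨a, b, M⟩ ⟨h, h'⟩
    simp only [Prod.mk.injEq, true_and]
    rw [mul_assoc, mul_assoc, mul_assoc, Ring.inverse_mul_cancel _ (hpu a h), mul_one,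
      ← mul_assoc, Ring.inverse_mul_cancel _ (hqu b h'), one_mul]
  right_inv' := by
    rintro ⟨a, b, M⟩ ⟨h, h'⟩
    simp only [Prod.mk.injEq, true_and]
    rw [mul_assoc, mul_assoc, mul_assoc, Ring.mul_inverse_cancel _ (hpu a h), mul_one,
      ← mul_assoc, Ring.mul_inverse_cancel _ (hqu b h'), one_mul]
  open_source := (hU.preimage continuous_fst).inter (hU'.preimage (by fun_prop))
  open_target := (hU.preimage continuous_fst).inter (hU'.preimage (by fun_prop))
  continuousOn_toFun := (contDiffOn_mul_fields hq (contDiffOn_ringInverse hp hpu)).continuousOn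
  continuousOn_invFun := (contDiffOn_mul_fields (contDiffOn_ringInverse hq hqu) hp).continuousOn

theorem isPartialDiffeo_fieldHomeo {U U' : Set E3} {p q : E3 → E3 →L[ℝ] E3} (hU : IsOpen U)
    (hU' : IsOpen U') (hp : ContDiffOn ℝ ∞ p U) (hq : ContDiffOn ℝ ∞ q U')
    (hpu : ∀ a ∈ U, IsUnit (p a)) (hqu : ∀ a ∈ U', IsUnit (q a)) :
    IsPartialDiffeo (fieldHomeo hU hU' hp hq hpu hqu) :=
  ⟨contDiffOn_mul_fields hq (contDiffOn_ringInverse hp hpu),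
    contDiffOn_mul_fields (contDiffOn_ringInverse hq hqu) hp⟩

/-- Coordinates of the arrows of the material groupoid. -/
def arrowCoord (W : Jet B → V) (g : (materialGroupoid W).Arrow) : Jet.Model := g.1.coord

/-- Regrouping of the factors of a product, the first three of them being replaced by a space of
coordinates. -/
def regroup {h m F : Type*} [NormedAddCommGroup h] [NormedSpace ℝ h] [NormedAddCommGroup m]
    [NormedSpace ℝ m] [NormedAddCommGroup F] [NormedSpace ℝ F] (κ : (E3 × E3 × h) ≃L[ℝ] F) :
    (E3 × E3 × (h × m)) ≃L[ℝ] F × m :=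
  ContinuousLinearEquiv.trans
    { toFun := fun x => ((x.1, x.2.1, x.2.2.1), x.2.2.2)
      invFun := fun x => (x.1.1, x.1.2.1, (x.1.2.2, x.2))
      map_add' := fun _ _ => rfl
      map_smul' := fun _ _ => rfl
      left_inv := fun _ => rfl
      right_inv := fun _ => rfl
      continuous_toFun := by fun_prop
      continuous_invFun := by fun_prop }
    (κ.prodCongr (ContinuousLinearEquiv.refl ℝ m))

/-- If p(a) and q(b) are material isomorphisms to X₀, then M : a → b is one iff q(b) M p(a)⁻¹
belongs to the isotropy group at X₀. The slice for that group is thus carried to any arrow. The last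
clause keeps source and target as coordinates, for the submersion property. -/
theorem exists_sliceChart (hW : IsSmoothlyUniform W) (X₀ : B) {h m F : Type*}
    [NormedAddCommGroup h] [NormedSpace ℝ h] [NormedAddCommGroup m] [NormedSpace ℝ m]
    [NormedAddCommGroup F] [NormedSpace ℝ F] (κ : (E3 × E3 × h) ≃L[ℝ] F)
    (e : OpenPartialHomeomorph (E3 →L[ℝ] E3) (h × m)) (he : IsPartialDiffeo e)
    (h1 : (1 : E3 →L[ℝ] E3) ∈ e.source) (heu : ∀ x ∈ e.source, IsUnit x)
    (heH : ∀ u : (E3 →L[ℝ] E3)ˣ, (u : E3 →L[ℝ] E3) ∈ e.source →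
      (u ∈ isotropy W X₀ ↔ (e u).2 = 0)) (g : (materialGroupoid W).Arrow) :
    ∃ s : SliceChart (arrowCoord W) F m, arrowCoord W g ∈ s.toHomeo.source ∧
      ∀ x ∈ s.toHomeo.source, (κ.symm (s.toHomeo x).1).1 = x.1 ∧
        (κ.symm (s.toHomeo x).1).2.1 = x.2.1 := by
  obtain ⟨g, hg⟩ := g
  obtain ⟨x, y, A, rfl⟩ : ∃ x y A, g = Jet.ofMatrix x y A := ⟨_, _, g.exists_eq_ofMatrix⟩
  obtain ⟨g', hg', hs, ht⟩ := hW.1 y X₀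
  obtain ⟨u, rfl⟩ : ∃ u, g' = Jet.ofMatrix y X₀ u := by
    obtain ⟨u, hu⟩ := g'.exists_eq_ofMatrix
    exact ⟨u, by rw [hu, hs, ht]⟩
  -- With p(x) = u A here and q(y) = u below, the arrow A is sent to q(y) A p(x)⁻¹ = 1, where the
  -- group slice is available.
  obtain ⟨U, p, hp, hxU, hpx⟩ := hW.exists_isMatrixField (isMaterialIso_mul hg' hg)
  obtain ⟨U', q, hq, hyU', hqy⟩ := hW.exists_isMatrixField hg'
  let T := fieldHomeo hp.isOpen hq.isOpen hp.contDiffOn hq.contDiffOn (fun _ => hp.isUnit)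
    (fun _ => hq.isUnit)
  have hT : IsPartialDiffeo T := isPartialDiffeo_fieldHomeo _ _ _ _ _ _
  let R := (OpenPartialHomeomorph.refl E3).prod ((OpenPartialHomeomorph.refl E3).prod e)
  have hR : IsPartialDiffeo R := IsPartialDiffeo.refl.prod (IsPartialDiffeo.refl.prod he)
  let Λ := (regroup (m := m) κ).toHomeomorph.toOpenPartialHomeomorph
  have hΛ : IsPartialDiffeo Λ := IsPartialDiffeo.of_continuousLinearEquiv _
  let S := T.trans (R.trans Λ)
  have hsrc : ∀ x : Jet.Model, x ∈ S.source ↔ (x.1 ∈ U ∧ x.2.1 ∈ U') ∧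
      q x.2.1 * x.2.2 * Ring.inverse (p x.1) ∈ e.source := by
    intro x
    simp [S, T, R, Λ, fieldHomeo]
  have hS : ∀ x : Jet.Model, S x =
      (κ (x.1, x.2.1, (e (q x.2.1 * x.2.2 * Ring.inverse (p x.1))).1),
        (e (q x.2.1 * x.2.2 * Ring.inverse (p x.1))).2) := fun x => rfl
  refine ⟨⟨S, hT.trans (hR.trans hΛ), ?_⟩, ?_, ?_⟩
  · rintro ⟨a, b, M⟩ hx
    rw [hsrc] at hx
    obtain ⟨⟨ha, hb⟩, hM⟩ := hx
    simp only at ha hb hM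
    obtain ⟨Z, v, rfl, hv, hvm⟩ := hp.exists_eq a ha
    obtain ⟨Z', v', rfl, hv', hvm'⟩ := hq.exists_eq b hb
    rw [hv, hv', Ring.inverse_unit] at hM
    -- The source of the chart consists of all matrices `M` meeting an open condition; since
    -- `e.source` contains only units, `M` is itself invertible and is the matrix of a jet.
    obtain ⟨w, hw⟩ := heu _ hM
    obtain ⟨N, rfl⟩ : ∃ N : (E3 →L[ℝ] E3)ˣ, M = N := by
      refine ⟨v'⁻¹ * w * v, ?_⟩
      rw [Units.val_mul, Units.val_mul, hw, mul_assoc, mul_assoc, mul_assoc, Units.inv_mul,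
        mul_one, ← mul_assoc, Units.inv_mul, one_mul]
    have hcalc : q (Body.ref Z') * (N : E3 →L[ℝ] E3) * Ring.inverse (p (Body.ref Z)) =
        ((v' * N * v⁻¹ : (E3 →L[ℝ] E3)ˣ) : E3 →L[ℝ] E3) := by
      rw [hv, hv', Ring.inverse_unit, Units.val_mul, Units.val_mul]
    rw [← Units.val_mul, ← Units.val_mul] at hM
    change _ ↔ (S _).2 = 0
    rw [hS]
    simp only
    rw [hcalc, ← heH _ hM, mem_isotropy]
    constructor
    · rintro ⟨⟨k, hk⟩, hk'⟩
      have hk' : k.coord = (Body.ref Z, Body.ref Z', (N : E3 →L[ℝ] E3)) := hk'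
      rw [← Jet.coord_ofMatrix] at hk'
      obtain rfl := Jet.coord_injective hk'
      exact isMaterialIso_mul (isMaterialIso_mul hvm' hk) (isMaterialIso_inv hvm)
    · intro hk
      have := isMaterialIso_mul (isMaterialIso_mul (isMaterialIso_inv hvm') hk) hvm
      refine ⟨⟨Jet.ofMatrix Z Z' N, ?_⟩, Jet.coord_ofMatrix _ _ _⟩
      have hN : v'⁻¹ * (v' * N * v⁻¹) * v = N := by group
      rwa [hN] at this
  · rw [hsrc]
    simp only [arrowCoord, Jet.coord_ofMatrix]
    refine ⟨⟨hxU, hyU'⟩, ?_⟩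
    rw [hpx, hqy, Ring.inverse_unit, ← Units.val_mul, ← Units.val_mul, mul_inv_cancel]
    exact h1
  · intro x hx
    simp [hS]

end Fields

end

/-! ### From smooth uniformity to an embedded Lie subgroupoid. -/

section

open Set

variable {B : Type*} [TopologicalSpace B] [ChartedSpace E3 B] [Body B]
  {V : Type*} {W : Jet B → V}

theorem secondCountableTopology_jet : SecondCountableTopology (Jet B) :=
  Jet.isOpenEmbedding_coord.isEmbedding.secondCountableTopology

theorem t2Space_jet : T2Space (Jet B) := Jet.isOpenEmbedding_coord.isEmbedding.t2Space

theorem coord_compFun {p : (materialGroupoid W).Arrow × (materialGroupoid W).Arrow}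
    (hp : p ∈ (materialGroupoid W).toGroupoid.composable) :
    arrowCoord W ((materialGroupoid W).toGroupoid.compFun p) =
      ((arrowCoord W p.2).1, (arrowCoord W p.1).2.1,
        (arrowCoord W p.1).2.2 * (arrowCoord W p.2).2.2) := by
  have hp : (materialGroupoid W).toGroupoid.src p.1 = (materialGroupoid W).toGroupoid.tgt p.2 := hp
  rw [GroupoidOver.compFun, dif_pos hp]
  exact Jet.coord_comp _ _ _

/-- The arrows receive the subspace topology, so the inclusion is a topological embedding and the
Hausdorff and countability properties are inherited. Slice charts supply the smooth structure, the
immersion and the two submersions. -/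
theorem isEmbeddedLieSubgroupoid_of_isSmoothlyUniform [TopologicalSpace V] [T2Space V]
    (hW : Continuous W) (hu : IsSmoothlyUniform W) :
    (materialGroupoid W).IsEmbeddedLieSubgroupoid 𝓘(ℝ, Jet.Model) (𝓡 3) := by
  obtain ⟨X₀⟩ := Body.nonempty (B := B)
  obtain ⟨h, m, hm, e, he, he1, heu, heH⟩ := exists_slice_of_isClosed (isClosed_isotropy hW X₀)
  obtain ⟨k, ⟨κ⟩⟩ : ∃ k, Nonempty ((E3 × E3 × h) ≃L[ℝ] EuclideanSpace ℝ (Fin k)) :=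
    ⟨_, ⟨toEuclidean⟩⟩
  have hsl := exists_sliceChart hu X₀ κ e he he1 heu heH
  let : TopologicalSpace (materialGroupoid W).Arrow := TopologicalSpace.induced Subtype.val inferInstance
  have hι : Topology.IsEmbedding (materialGroupoid W).incl := ⟨⟨rfl⟩, Subtype.val_injective⟩
  have hj : Topology.IsEmbedding (arrowCoord W) := Jet.isOpenEmbedding_coord.isEmbedding.comp hι
  have hsl' : ∀ g, ∃ s : SliceChart (arrowCoord W) (EuclideanSpace ℝ (Fin k)) m,
      arrowCoord W g ∈ s.toHomeo.source := fun g => (hsl g).imp fun s hs => hs.1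
  have : Nonempty (materialGroupoid W).Arrow := ⟨⟨Jet.one X₀, (materialGroupoid W).one_mem X₀⟩⟩
  let : ChartedSpace (EuclideanSpace ℝ (Fin k)) (materialGroupoid W).Arrow :=
    chartedSpaceOfSlices hj hsl'
  have hmf : IsManifold (𝓡 k) ∞ (materialGroupoid W).Arrow :=
    isManifold_chartedSpaceOfSlices hj hsl'
  -- The slices take values in F × m; this identifies it with the model of the jets through the
  -- decomposition of the matrix space as h ⊕ m.
  let L : (EuclideanSpace ℝ (Fin k) × m) ≃L[ℝ] Jet.Model :=
    (regroup κ).symm.trans ((ContinuousLinearEquiv.refl ℝ E3).prodCongr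
      ((ContinuousLinearEquiv.refl ℝ E3).prodCongr
        (h.prodEquivOfIsCompl m hm).toContinuousLinearEquiv))
  have himm : Manifold.IsImmersion (𝓡 k) 𝓘(ℝ, Jet.Model) ∞ (materialGroupoid W).incl :=
    (isImmersion_of_slices hj hsl' coordHomeo_mem_maximalAtlas coordHomeo_source
      (fun _ => rfl) L).isImmersion
  have hcoord : ContMDiff (𝓡 k) 𝓘(ℝ, Jet.Model) ∞ (arrowCoord W) :=
    contMDiff_coord.comp himm.contMDiff
  have hsrc : ContMDiff (𝓡 k) (𝓡 3) ∞ (materialGroupoid W).toGroupoid.src := by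
    intro g
    rw [← contMDiffWithinAt_univ, contMDiffWithinAt_iff_ref]
    exact (contDiff_fst.contMDiff.comp hcoord) g
  have htgt : ContMDiff (𝓡 k) (𝓡 3) ∞ (materialGroupoid W).toGroupoid.tgt := by
    intro g
    rw [← contMDiffWithinAt_univ, contMDiffWithinAt_iff_ref]
    exact (contDiff_snd.fst.contMDiff.comp hcoord) g
  refine ⟨k, inferInstance, inferInstance, ?_, ?_, ⟨himm, hι⟩, ?_⟩
  · have := t2Space_jet (B := B)
    exact hι.t2Space
  · have := secondCountableTopology_jet (B := B)
    exact hι.secondCountableTopology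
  · refine ⟨hmf, Body.isManifold, hsrc, htgt, ?_, ?_, ?_, ?_, ?_⟩
    · intro x
      refine contMDiffWithinAt_of_comp_slices hj hsl' ?_
      have h1 : (fun y => arrowCoord W ((materialGroupoid W).toGroupoid.one y)) =
          fun y => (Body.ref y, Body.ref y, 1) := funext Jet.coord_one
      rw [h1]
      exact ((Body.contMDiff_ref x).prodMk_space ((Body.contMDiff_ref x).prodMk_space
        contMDiffAt_const))
    · intro g
      refine contMDiffWithinAt_of_comp_slices hj hsl' ?_
      have h1 : (fun g => arrowCoord W ((materialGroupoid W).toGroupoid.inv g)) =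
          (fun x : Jet.Model => ((x.2.1, x.1, Ring.inverse x.2.2) : Jet.Model)) ∘ arrowCoord W :=
        funext fun g => Jet.coord_inv g.1
      rw [h1]
      have h2 : ContDiffAt ℝ ∞ Ring.inverse (arrowCoord W g).2.2 :=
        contDiffAt_ringInverse ℝ (Jet.matrix g.1)
      have h3 : ContDiffAt ℝ ∞ (fun x : Jet.Model => ((x.2.1, x.1, Ring.inverse x.2.2) : Jet.Model))
          (arrowCoord W g) :=
        contDiff_snd.fst.contDiffAt.prodMk (contDiff_fst.contDiffAt.prodMk
          (ContDiffAt.comp (arrowCoord W g) (g := Ring.inverse) (f := fun x : Jet.Model => x.2.2)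
            h2 contDiff_snd.snd.contDiffAt))
      exact h3.contMDiffAt.comp g hcoord.contMDiffAt
    · intro p hp
      refine contMDiffWithinAt_of_comp_slices hj hsl' ?_
      have h1 : ContMDiff ((𝓡 k).prod (𝓡 k)) 𝓘(ℝ, Jet.Model) ∞
          fun p : (materialGroupoid W).Arrow × (materialGroupoid W).Arrow => arrowCoord W p.1 :=
        hcoord.comp contMDiff_fst
      have h2 : ContMDiff ((𝓡 k).prod (𝓡 k)) 𝓘(ℝ, Jet.Model) ∞
          fun p : (materialGroupoid W).Arrow × (materialGroupoid W).Arrow => arrowCoord W p.2 :=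
        hcoord.comp contMDiff_snd
      -- This polynomial map is defined on all pairs and agrees with the composition on composable
      -- ones, which is all that is needed.
      have h3 : ContDiff ℝ ∞ fun x : Jet.Model × Jet.Model =>
          ((x.2.1, x.1.2.1, x.1.2.2 * x.2.2.2) : Jet.Model) :=
        contDiff_snd.fst.prodMk (contDiff_fst.snd.fst.prodMk
          (contDiff_fst.snd.snd.mul contDiff_snd.snd.snd))
      exact ((h3.contMDiff.comp (h1.prodMk_space h2)) p).contMDiffWithinAt.congr
        (fun q hq => coord_compFun hq) (coord_compFun hp)
    · intro g
      obtain ⟨s, hs, hκ⟩ := hsl g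
      exact isSubmersionAt_of_slices hj hsl' refHomeo_mem_maximalAtlas refHomeo_source s κ.symm
        (fun b hb => ((hκ _ hb).1).symm) hs
    · intro g
      obtain ⟨s, hs, hκ⟩ := hsl g
      -- The swap puts the target coordinate first, as the submersion normal form requires.
      let σ : (E3 × E3 × h) ≃L[ℝ] E3 × E3 × h :=
        { toFun := fun x => (x.2.1, x.1, x.2.2)
          invFun := fun x => (x.2.1, x.1, x.2.2)
          map_add' := fun _ _ => rfl
          map_smul' := fun _ _ => rfl
          left_inv := fun _ => rfl
          right_inv := fun _ => rfl
          continuous_toFun := by fun_prop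
          continuous_invFun := by fun_prop }
      exact isSubmersionAt_of_slices hj hsl' refHomeo_mem_maximalAtlas refHomeo_source s
        (κ.symm.trans σ) (fun b hb => ((hκ _ hb).2).symm) hs

end

section

open Set Module

/-! ### Local right inverses and images of maps of constant rank. -/

section ConstantRank

variable {F E' : Type*} [NormedAddCommGroup F] [NormedSpace ℝ F]
  [NormedAddCommGroup E'] [NormedSpace ℝ E'] [FiniteDimensional ℝ E']

/-- A smooth function with surjective derivative has smooth local right inverses. -/
theorem exists_smooth_rightInverse {f : F → E'} {O : Set F} (hO : IsOpen O)
    (hf : ContDiffOn ℝ ∞ f O) {v₀ : F} (hv₀ : v₀ ∈ O)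
    (hs : Function.Surjective (fderiv ℝ f v₀)) :
    ∃ (U : Set E') (r : E' → F), IsOpen U ∧ f v₀ ∈ U ∧ ContDiffOn ℝ ∞ r U ∧ r (f v₀) = v₀ ∧
      (∀ y ∈ U, r y ∈ O) ∧ ∀ y ∈ U, f (r y) = y := by
  obtain ⟨R, hR⟩ := (fderiv ℝ f v₀ : F →ₗ[ℝ] E').exists_rightInverse_of_surjective
    (LinearMap.range_eq_top.2 hs)
  let R' : E' →L[ℝ] F := LinearMap.toContinuousLinearMap R
  have hRR : ∀ y, fderiv ℝ f v₀ (R' y) = y := fun y => LinearMap.congr_fun hR y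
  -- On this affine slice, directed by a linear section of the derivative, `f` has derivative the
  -- identity, so the inverse function theorem applies.
  let τ : E' → F := fun y => v₀ + R' y
  have hτ : ContDiff ℝ ∞ τ := contDiff_const.add R'.contDiff
  have hτ0 : τ 0 = v₀ := by simp [τ]
  have hd : HasFDerivAt (f ∘ τ) ((ContinuousLinearEquiv.refl ℝ E' : E' ≃L[ℝ] E') : E' →L[ℝ] E')
      0 := by
    have h1 : HasFDerivAt f (fderiv ℝ f v₀) (τ 0) := by
      rw [hτ0]
      exact ((hf.contDiffAt (hO.mem_nhds hv₀)).differentiableAt (by simp)).hasFDerivAt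
    refine (h1.comp 0 (R'.hasFDerivAt.const_add v₀)).congr_fderiv ?_
    ext y
    exact hRR y
  have : CompleteSpace E' := FiniteDimensional.complete ℝ E'
  obtain ⟨e, he, h0, heO, hef⟩ := exists_isPartialDiffeo (hO.preimage hτ.continuous)
    (hf.comp hτ.contDiffOn fun _ h => h) (by simpa [hτ0] using hv₀) hd
  have hf0 : e 0 = f v₀ := by rw [hef, Function.comp_apply, hτ0]
  refine ⟨e.target, τ ∘ e.symm, e.open_target, hf0 ▸ e.map_source h0,
    hτ.comp_contDiffOn he.contDiffOn_symm, ?_, fun y hy => heO (e.map_target hy), fun y hy => ?_⟩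
  · rw [← hf0, Function.comp_apply, e.left_inv h0, hτ0]
  · exact (hef _).symm.trans (e.right_inv hy)

/-- A weak form of the constant rank theorem: the image of a smooth function of constant rank `r`
is locally of dimension at most `r`. -/
theorem exists_dimH_image_le_of_finrank_range_eq [FiniteDimensional ℝ F] {f : F → E'} {O : Set F}
    (hO : IsOpen O) (hf : ContDiffOn ℝ ∞ f O) {r : ℕ}
    (hr : ∀ v ∈ O, finrank ℝ (LinearMap.range (fderiv ℝ f v : F →ₗ[ℝ] E')) = r) {v₀ : F}
    (hv₀ : v₀ ∈ O) : ∃ N ∈ 𝓝 v₀, dimH (f '' N) ≤ r := by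
  set A : F →ₗ[ℝ] E' := (fderiv ℝ f v₀ : F →ₗ[ℝ] E') with hA
  obtain ⟨π₀, hπ₀⟩ := (LinearMap.id : LinearMap.range A →ₗ[ℝ] LinearMap.range A).exists_extend
  obtain ⟨κ₀, hκ₀⟩ := (LinearMap.id : LinearMap.ker A →ₗ[ℝ] LinearMap.ker A).exists_extend
  let π : E' →L[ℝ] LinearMap.range A := LinearMap.toContinuousLinearMap π₀
  let κ : F →L[ℝ] LinearMap.ker A := LinearMap.toContinuousLinearMap κ₀
  have hπ : ∀ w, π (A w) = ⟨A w, w, rfl⟩ := fun w =>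
    LinearMap.congr_fun hπ₀ ⟨A w, w, rfl⟩
  have hκ : ∀ w (hw : w ∈ LinearMap.ker A), κ w = ⟨w, hw⟩ := fun w hw =>
    LinearMap.congr_fun hκ₀ ⟨w, hw⟩
  -- the coordinates adapted to `f`
  let θ : F → LinearMap.range A × LinearMap.ker A := fun v => (π (f v), κ v)
  have hθ : ContDiffOn ℝ ∞ θ O := (π.contDiff.comp_contDiffOn hf).prodMk κ.contDiff.contDiffOn
  let D₀ : F →ₗ[ℝ] LinearMap.range A × LinearMap.ker A := (π₀.comp A).prod κ₀
  have hD₀ : Function.Injective D₀ := by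
    rw [← LinearMap.ker_eq_bot, LinearMap.ker_eq_bot']
    intro w hw
    obtain ⟨h1, h2⟩ := Prod.ext_iff.1 hw
    have h3 : A w = 0 := congrArg Subtype.val ((hπ w).symm.trans h1)
    exact congrArg Subtype.val ((hκ w h3).symm.trans h2)
  have hfin : finrank ℝ F = finrank ℝ (LinearMap.range A × LinearMap.ker A) := by
    rw [finrank_prod, LinearMap.finrank_range_add_finrank_ker]
  let D : F ≃L[ℝ] LinearMap.range A × LinearMap.ker A :=
    (LinearEquiv.ofInjectiveOfFinrankEq D₀ hD₀ hfin).toContinuousLinearEquiv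
  have hD : HasFDerivAt θ (D : F →L[ℝ] LinearMap.range A × LinearMap.ker A) v₀ := by
    have h1 : HasFDerivAt f (fderiv ℝ f v₀) v₀ :=
      ((hf.contDiffAt (hO.mem_nhds hv₀)).differentiableAt (by simp)).hasFDerivAt
    refine ((π.hasFDerivAt.comp v₀ h1).prodMk κ.hasFDerivAt).congr_fderiv ?_
    ext1 w
    rfl
  have : CompleteSpace F := FiniteDimensional.complete ℝ F
  obtain ⟨e, he, h0, heO, heθ⟩ := exists_isPartialDiffeo hO hθ hv₀ hD
  obtain ⟨ε, hε, hball⟩ := Metric.isOpen_iff.1 e.open_target _ (e.map_source h0)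
  let g : LinearMap.range A × LinearMap.ker A → E' := f ∘ e.symm
  have hg : ContDiffOn ℝ ∞ g e.target := hf.comp he.contDiffOn_symm fun y hy => heO (e.map_target hy)
  have hgd : ∀ y ∈ e.target, HasFDerivAt g (fderiv ℝ g y) y := fun y hy =>
    ((hg.contDiffAt (e.open_target.mem_nhds hy)).differentiableAt (by simp)).hasFDerivAt
  have hπg : ∀ y ∈ e.target, π (g y) = y.1 := by
    intro y hy
    have h1 := heθ (e.symm y)
    rw [e.right_inv hy] at h1
    exact (congrArg Prod.fst h1).symm
  -- Since π ∘ g is the first coordinate, π maps the range of df onto the range of `A`; equality of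
  -- ranks makes it injective there. The vector dg(0, b) lies in the range of df and is killed by π,
  -- so it vanishes. Hence `g` depends locally on r variables only.
  have hg0 : ∀ y ∈ e.target, ∀ b, fderiv ℝ g y (0, b) = 0 := by
    intro y hy b
    have hπd : ∀ z, π (fderiv ℝ g y z) = z.1 := by
      have h1 : HasFDerivAt (fun y => π (g y)) (π.comp (fderiv ℝ g y)) y :=
        π.hasFDerivAt.comp y (hgd y hy)
      have h2 : HasFDerivAt (fun y => π (g y)) (ContinuousLinearMap.fst ℝ _ _) y :=
        (hasFDerivAt_fst (𝕜 := ℝ)).congr_of_eventuallyEq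
          (Filter.eventuallyEq_of_mem (e.open_target.mem_nhds hy) hπg)
      exact fun z => congrArg (fun T => T z) (h1.unique h2)
    have hy' : e.symm y ∈ O := heO (e.map_target hy)
    have hsymm : HasFDerivAt e.symm (fderiv ℝ e.symm y) y :=
      ((he.contDiffOn_symm.contDiffAt (e.open_target.mem_nhds hy)).differentiableAt
        (by simp)).hasFDerivAt
    have hfd : HasFDerivAt f (fderiv ℝ f (e.symm y)) (e.symm y) :=
      ((hf.contDiffAt (hO.mem_nhds hy')).differentiableAt (by simp)).hasFDerivAt
    have hcomp : fderiv ℝ g y = (fderiv ℝ f (e.symm y)).comp (fderiv ℝ e.symm y) :=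
      (hfd.comp y hsymm).fderiv
    let Q : LinearMap.range (fderiv ℝ f (e.symm y) : F →ₗ[ℝ] E') →ₗ[ℝ] LinearMap.range A :=
      (π : E' →ₗ[ℝ] LinearMap.range A).domRestrict _
    have hQs : Function.Surjective Q := by
      intro a
      refine ⟨⟨fderiv ℝ g y (a, 0), ?_⟩, hπd (a, 0)⟩
      rw [hcomp]
      exact ⟨_, rfl⟩
    have hQi : Function.Injective Q :=
      (LinearMap.injective_iff_surjective_of_finrank_eq_finrank
        ((hr _ hy').trans (hr _ hv₀).symm)).2 hQs
    have hmem : fderiv ℝ g y (0, b) ∈ LinearMap.range (fderiv ℝ f (e.symm y) : F →ₗ[ℝ] E') := by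
      rw [hcomp]
      exact ⟨_, rfl⟩
    have h3 : Q ⟨_, hmem⟩ = Q 0 := by
      rw [map_zero]
      exact hπd (0, b)
    exact congrArg Subtype.val (hQi h3)
  set y₀ := e v₀ with hy₀
  have hprod : Metric.ball y₀.1 ε ×ˢ Metric.ball y₀.2 ε = Metric.ball y₀ ε := ball_prod_same _ _ _
  have hconst : ∀ a ∈ Metric.ball y₀.1 ε, ∀ b ∈ Metric.ball y₀.2 ε, g (a, b) = g (a, y₀.2) := by
    intro a ha b hb
    have hm : ∀ b ∈ Metric.ball y₀.2 ε, (a, b) ∈ e.target := fun b hb =>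
      hball (hprod ▸ mk_mem_prod ha hb)
    have hd : ∀ b ∈ Metric.ball y₀.2 ε, HasFDerivAt (𝕜 := ℝ) (fun b => g (a, b)) 0 b := by
      intro b hb
      refine ((hgd _ (hm b hb)).comp b (hasFDerivAt_prodMk_right a b)).congr_fderiv ?_
      ext z
      exact hg0 _ (hm b hb) z
    exact Metric.isOpen_ball.is_const_of_fderiv_eq_zero (𝕜 := ℝ) (convex_ball _ _).isPreconnected
      (fun b hb => (hd b hb).differentiableAt.differentiableWithinAt) (fun b hb => (hd b hb).fderiv)
      hb (Metric.mem_ball_self hε)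
  refine ⟨e.source ∩ e ⁻¹' Metric.ball y₀ ε, Filter.inter_mem (e.open_source.mem_nhds h0)
    ((e.continuousAt h0).preimage_mem_nhds (Metric.ball_mem_nhds _ hε)), ?_⟩
  have himg : f '' (e.source ∩ e ⁻¹' Metric.ball y₀ ε) ⊆
      (fun a => g (a, y₀.2)) '' Metric.ball y₀.1 ε := by
    rintro _ ⟨v, ⟨hv, hvb⟩, rfl⟩
    rw [mem_preimage, ← hprod] at hvb
    refine ⟨(e v).1, hvb.1, ?_⟩
    change g _ = _
    rw [← hconst _ hvb.1 _ hvb.2]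
    change f (e.symm (e v)) = _
    rw [e.left_inv hv]
  have hsm : ContDiffOn ℝ 1 (fun a => g (a, y₀.2)) (Metric.ball y₀.1 ε) :=
    (hg.of_le (by simp)).comp (contDiff_id.prodMk contDiff_const).contDiffOn fun a ha =>
      hball (hprod ▸ mk_mem_prod ha (Metric.mem_ball_self hε))
  calc dimH (f '' (e.source ∩ e ⁻¹' Metric.ball y₀ ε))
      ≤ dimH ((fun a => g (a, y₀.2)) '' Metric.ball y₀.1 ε) := dimH_mono himg
    _ ≤ dimH (Metric.ball y₀.1 ε) := hsm.dimH_image_le (convex_ball _ _) Subset.rfl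
    _ ≤ dimH (univ : Set (LinearMap.range A)) := dimH_mono (subset_univ _)
    _ = finrank ℝ (LinearMap.range A) := Real.dimH_univ_eq_finrank _
    _ = r := by rw [hr v₀ hv₀]

end ConstantRank

end

section

open Set Module

/-! ### Kernels of two surjective linear maps. -/

section LinearAlgebra

variable {T N : Type*} [AddCommGroup T] [Module ℝ T] [FiniteDimensional ℝ T] [AddCommGroup N]
  [Module ℝ N]

theorem finrank_map_ker_add (a b : T →ₗ[ℝ] N) :
    finrank ℝ ((LinearMap.ker b).map a) +
      finrank ℝ (LinearMap.ker a ⊓ LinearMap.ker b : Submodule ℝ T) =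
      finrank ℝ (LinearMap.ker b) := by
  have h := LinearMap.finrank_range_add_finrank_ker (a.domRestrict (LinearMap.ker b))
  rw [LinearMap.range_domRestrict] at h
  rw [← h, LinearMap.ker_domRestrict]
  have h2 := (Submodule.equivMapOfInjective (LinearMap.ker b).subtype Subtype.val_injective
    ((LinearMap.ker a).comap (LinearMap.ker b).subtype)).finrank_eq
  rw [Submodule.map_comap_subtype, inf_comm] at h2
  rw [h2]

/-- Both sides are the dimension of a kernel minus that of ker a ∩ ker b, and surjectivity gives the
two kernels the same dimension. -/
theorem finrank_map_ker_comm {a b : T →ₗ[ℝ] N} (ha : Function.Surjective a)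
    (hb : Function.Surjective b) :
    finrank ℝ ((LinearMap.ker b).map a) = finrank ℝ ((LinearMap.ker a).map b) := by
  have h1 := finrank_map_ker_add a b
  have h2 := finrank_map_ker_add b a
  rw [inf_comm] at h2
  have h3 := LinearMap.finrank_range_add_finrank_ker a
  have h4 := LinearMap.finrank_range_add_finrank_ker b
  rw [LinearMap.range_eq_top.2 ha, finrank_top] at h3
  rw [LinearMap.range_eq_top.2 hb, finrank_top] at h4
  omega

end LinearAlgebra

/-! ### Parametrizing the fibres of a submersion. -/

section Fibres

universe u

variable {E : Type u} {E' Γ M : Type*} [NormedAddCommGroup E] [NormedSpace ℝ E]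
  [NormedAddCommGroup E'] [NormedSpace ℝ E']
  [TopologicalSpace Γ] [ChartedSpace E Γ] [TopologicalSpace M] [ChartedSpace E' M]

/-- A parametrization of the fibre of `t` through `g`, around `g`. -/
structure FibreParam (t : Γ → M) (g : Γ) (F : Type*) [NormedAddCommGroup F] [NormedSpace ℝ F] where
  toFun : F → Γ
  dom : Set F
  pt : F
  isOpen : IsOpen dom
  mem : pt ∈ dom
  map_pt : toFun pt = g
  contMDiffOn : ContMDiffOn 𝓘(ℝ, F) 𝓘(ℝ, E) ∞ toFun dom
  apply_eq : ∀ v ∈ dom, t (toFun v) = t g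
  mem_range : ∀ v ∈ dom, ∀ w : TangentSpace 𝓘(ℝ, E) (toFun v),
    mfderiv 𝓘(ℝ, E) 𝓘(ℝ, E') t (toFun v) w = 0 →
      ∃ η : F, mfderiv 𝓘(ℝ, F) 𝓘(ℝ, E) toFun v η = w
  image_mem_nhds : ∀ N ∈ 𝓝 pt, toFun '' (N ∩ dom) ∈ 𝓝[t ⁻¹' {t g}] g

theorem mdifferentiable_of_mem_maximalAtlas [IsManifold 𝓘(ℝ, E) ∞ Γ]
    {φ : OpenPartialHomeomorph Γ E} (hφ : φ ∈ IsManifold.maximalAtlas 𝓘(ℝ, E) ∞ Γ) :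
    φ.MDifferentiable 𝓘(ℝ, E) 𝓘(ℝ, E) :=
  ⟨(contMDiffOn_of_mem_maximalAtlas hφ).mdifferentiableOn (by simp),
    (contMDiffOn_symm_of_mem_maximalAtlas hφ).mdifferentiableOn (by simp)⟩

theorem codChart_apply {t : Γ → M} {g : Γ}
    (h : Manifold.IsSubmersionAt 𝓘(ℝ, E) 𝓘(ℝ, E') ∞ t g) {x : E} (hx : x ∈ h.domChart.target) :
    h.codChart (t (h.domChart.symm x)) = (h.equiv x).1 := by
  have hx' : x ∈ (h.domChart.extend 𝓘(ℝ, E)).target := by simpa using hx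
  exact h.writtenInCharts hx'

variable [IsManifold 𝓘(ℝ, E) ∞ Γ] [IsManifold 𝓘(ℝ, E') ∞ M]

theorem mfderiv_eq_fst_of_isSubmersionAt {t : Γ → M} {g : Γ}
    (h : Manifold.IsSubmersionAt 𝓘(ℝ, E) 𝓘(ℝ, E') ∞ t g) {γ : Γ} (hγ : γ ∈ h.domChart.source)
    (w : TangentSpace 𝓘(ℝ, E) γ) :
    mfderiv 𝓘(ℝ, E') 𝓘(ℝ, E') h.codChart (t γ) (mfderiv 𝓘(ℝ, E) 𝓘(ℝ, E') t γ w) =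
      (h.equiv (mfderiv 𝓘(ℝ, E) 𝓘(ℝ, E) h.domChart γ w)).1 := by
  have hψ := mdifferentiable_of_mem_maximalAtlas h.codChart_mem_maximalAtlas
  have hφ := mdifferentiable_of_mem_maximalAtlas h.domChart_mem_maximalAtlas
  have ht : MDifferentiableAt 𝓘(ℝ, E) 𝓘(ℝ, E') t γ :=
    ((h.contMDiffOn).contMDiffAt (h.domChart.open_source.mem_nhds hγ)).mdifferentiableAt (by simp)
  have h1 : h.codChart ∘ t =ᶠ[𝓝 γ]
      ((ContinuousLinearMap.fst ℝ E' h.complement).comp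
        (h.equiv : E →L[ℝ] E' × h.complement)) ∘ h.domChart := by
    filter_upwards [h.domChart.open_source.mem_nhds hγ] with x hx
    have := codChart_apply h (h.domChart.map_source hx)
    rwa [h.domChart.left_inv hx] at this
  have h2 := h1.mfderiv_eq (I := 𝓘(ℝ, E)) (I' := 𝓘(ℝ, E'))
  rw [mfderiv_comp γ (hψ.mdifferentiableAt (h.source_subset_preimage_source hγ)) ht,
    mfderiv_comp γ (ContinuousLinearMap.mdifferentiableAt _) (hφ.mdifferentiableAt hγ),
    ContinuousLinearMap.mfderiv_eq] at h2
  exact congrArg (fun T => T w) h2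

theorem surjective_mfderiv_of_isSubmersionAt {t : Γ → M} {g : Γ}
    (h : Manifold.IsSubmersionAt 𝓘(ℝ, E) 𝓘(ℝ, E') ∞ t g) :
    Function.Surjective (mfderiv 𝓘(ℝ, E) 𝓘(ℝ, E') t g) := by
  have hψ := mdifferentiable_of_mem_maximalAtlas h.codChart_mem_maximalAtlas
  have hφ := mdifferentiable_of_mem_maximalAtlas h.domChart_mem_maximalAtlas
  intro y
  obtain ⟨w, hw⟩ := hφ.mfderiv_surjective h.mem_domChart_source (h.equiv.symm
    (mfderiv 𝓘(ℝ, E') 𝓘(ℝ, E') h.codChart (t g) y, 0))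
  refine ⟨w, hψ.mfderiv_injective h.mem_codChart_source ?_⟩
  rw [mfderiv_eq_fst_of_isSubmersionAt h h.mem_domChart_source, hw]
  exact congrArg Prod.fst (h.equiv.apply_symm_apply _)

/-- In submersion charts the fibre is the affine slice with first component fixed at a₀,
parametrized by the complement. Its directions are exactly the kernel of the derivative. -/
theorem exists_fibreParam {t : Γ → M} {g : Γ}
    (h : Manifold.IsSubmersionAt 𝓘(ℝ, E) 𝓘(ℝ, E') ∞ t g) :
    Nonempty (FibreParam (E := E) (E' := E') t g h.complement) := by
  have hψ := mdifferentiable_of_mem_maximalAtlas h.codChart_mem_maximalAtlas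
  have hφ := mdifferentiable_of_mem_maximalAtlas h.domChart_mem_maximalAtlas
  have hw : ∀ x ∈ h.domChart.target, h.codChart (t (h.domChart.symm x)) = (h.equiv x).1 :=
    fun x hx => codChart_apply h hx
  let a₀ : E' := (h.equiv (h.domChart g)).1
  let ℓ : h.complement → E := fun v => h.equiv.symm (a₀, v)
  have hℓ : ContDiff ℝ ∞ ℓ := h.equiv.symm.contDiff.comp (contDiff_const.prodMk contDiff_id)
  have hℓd : ∀ v, HasFDerivAt ℓ ((h.equiv.symm : E' × h.complement →L[ℝ] E).comp
      (ContinuousLinearMap.inr ℝ E' h.complement)) v := fun v =>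
    h.equiv.symm.hasFDerivAt.comp v (hasFDerivAt_prodMk_right a₀ v)
  have hpt : ℓ (h.equiv (h.domChart g)).2 = h.domChart g := h.equiv.symm_apply_apply _
  have hψg : h.codChart (t g) = a₀ := by
    have := hw _ (h.domChart.map_source h.mem_domChart_source)
    rwa [h.domChart.left_inv h.mem_domChart_source] at this
  have hc : ContMDiffOn 𝓘(ℝ, h.complement) 𝓘(ℝ, E) ∞ (fun v => h.domChart.symm (ℓ v))
      (ℓ ⁻¹' h.domChart.target) :=
    (contMDiffOn_symm_of_mem_maximalAtlas h.domChart_mem_maximalAtlas).comp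
      hℓ.contMDiff.contMDiffOn fun _ hv => hv
  have hO : IsOpen (ℓ ⁻¹' h.domChart.target) := h.domChart.open_target.preimage hℓ.continuous
  refine ⟨⟨fun v => h.domChart.symm (ℓ v), ℓ ⁻¹' h.domChart.target, (h.equiv (h.domChart g)).2,
    hO, ?_, ?_, hc, ?_, ?_, ?_⟩⟩
  · rw [mem_preimage, hpt]
    exact h.domChart.map_source h.mem_domChart_source
  · rw [hpt, h.domChart.left_inv h.mem_domChart_source]
  · intro v hv
    have h1 : h.codChart (t (h.domChart.symm (ℓ v))) = h.codChart (t g) := by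
      have h2 : h.equiv (ℓ v) = (a₀, v) := h.equiv.apply_symm_apply _
      rw [hw _ hv, hψg, h2]
    exact h.codChart.injOn (h.source_subset_preimage_source (h.domChart.map_target hv))
      h.mem_codChart_source h1
  · intro v hv w hw0
    have hs := h.domChart.map_target hv
    have h1 := mfderiv_eq_fst_of_isSubmersionAt h hs w
    rw [hw0, map_zero] at h1
    refine ⟨(h.equiv (mfderiv 𝓘(ℝ, E) 𝓘(ℝ, E) h.domChart (h.domChart.symm (ℓ v)) w)).2,
      hφ.mfderiv_injective hs ?_⟩
    have hcd : MDifferentiableAt 𝓘(ℝ, h.complement) 𝓘(ℝ, E) (fun v => h.domChart.symm (ℓ v)) v :=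
      (hc.contMDiffAt (hO.mem_nhds hv)).mdifferentiableAt (by simp)
    have h2 : h.domChart ∘ (fun v => h.domChart.symm (ℓ v)) =ᶠ[𝓝 v] ℓ := by
      filter_upwards [hO.mem_nhds hv] with x hx
      exact h.domChart.right_inv hx
    have h3 := h2.mfderiv_eq (I := 𝓘(ℝ, h.complement)) (I' := 𝓘(ℝ, E))
    rw [mfderiv_comp v (hφ.mdifferentiableAt hs) hcd, mfderiv_eq_fderiv, (hℓd v).fderiv] at h3
    refine (DFunLike.congr_fun h3 _).trans ?_
    refine (congrArg h.equiv.symm ?_).trans (h.equiv.symm_apply_apply _)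
    exact Prod.ext h1 rfl
  -- A point of the fibre near `g` is recovered from its complement component. So the
  -- parametrization covers a neighbourhood within the fibre, which later permits a countable cover
  -- of it.
  · intro N hN
    have hcont : ContinuousAt (fun γ => (h.equiv (h.domChart γ)).2) g :=
      (continuous_snd.comp h.equiv.continuous).continuousAt.comp
        (h.domChart.continuousAt h.mem_domChart_source)
    have h1 := hcont.preimage_mem_nhds hN
    filter_upwards [mem_nhdsWithin_of_mem_nhds h1, self_mem_nhdsWithin,
      mem_nhdsWithin_of_mem_nhds (h.domChart.open_source.mem_nhds h.mem_domChart_source)]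
      with γ hγN hγt hγs
    have hγt : t γ = t g := hγt
    have h2 : ℓ (h.equiv (h.domChart γ)).2 = h.domChart γ := by
      have h3 := hw _ (h.domChart.map_source hγs)
      rw [h.domChart.left_inv hγs, hγt, hψg] at h3
      change h.equiv.symm (a₀, _) = _
      rw [h3]
      exact h.equiv.symm_apply_apply _
    refine ⟨(h.equiv (h.domChart γ)).2, ⟨hγN, ?_⟩, ?_⟩
    · rw [mem_preimage, h2]
      exact h.domChart.map_source hγs
    · change h.domChart.symm (ℓ _) = γ
      rw [h2, h.domChart.left_inv hγs]

end Fibres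

end

section

open Set Module

/-! ### The rank of one map along the fibres of another. -/

section Rank

universe u

variable {E : Type u} {E' F Γ M : Type*} [NormedAddCommGroup E] [NormedSpace ℝ E]
  [NormedAddCommGroup E'] [NormedSpace ℝ E'] [NormedAddCommGroup F] [NormedSpace ℝ F]
  [TopologicalSpace Γ] [ChartedSpace E Γ] [TopologicalSpace M] [ChartedSpace E' M]

/-- The derivative of a map at a point, as a linear map between the model spaces. -/
def tangentMapAt (f : Γ → M) (g : Γ) : E →ₗ[ℝ] E' :=
  let T : E →L[ℝ] E' := mfderiv 𝓘(ℝ, E) 𝓘(ℝ, E') f g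
  T.toLinearMap

theorem tangentMapAt_comp {N : Type*} [TopologicalSpace N] [ChartedSpace F N] {f : M → Γ} {h : N → M}
    {x : N} (hf : MDifferentiableAt 𝓘(ℝ, E') 𝓘(ℝ, E) f (h x))
    (hh : MDifferentiableAt 𝓘(ℝ, F) 𝓘(ℝ, E') h x) :
    (tangentMapAt (fun y => f (h y)) x : F →ₗ[ℝ] E) =
      (tangentMapAt f (h x) : E' →ₗ[ℝ] E).comp (tangentMapAt h x : F →ₗ[ℝ] E') := by
  refine LinearMap.ext fun v => ?_
  exact DFunLike.congr_fun (mfderiv_comp x hf hh) v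

theorem tangentMapAt_congr {f f' : Γ → M} {g : Γ} (h : f =ᶠ[𝓝 g] f') :
    (tangentMapAt f g : E →ₗ[ℝ] E') = tangentMapAt f' g := by
  refine LinearMap.ext fun v => ?_
  exact DFunLike.congr_fun (h.mfderiv_eq (I := 𝓘(ℝ, E)) (I' := 𝓘(ℝ, E'))) v

theorem tangentMapAt_const (y : M) (g : Γ) :
    (tangentMapAt (fun _ : Γ => y) g : E →ₗ[ℝ] E') = 0 := by
  refine LinearMap.ext fun v => ?_
  exact DFunLike.congr_fun (mfderiv_const (I := 𝓘(ℝ, E)) (I' := 𝓘(ℝ, E')) (c := y) (x := g)) v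

/-- The rank at `g` of the restriction of `s` to the fibres of `t`. -/
def fibreRank (E E' : Type*) [NormedAddCommGroup E] [NormedSpace ℝ E]
    [NormedAddCommGroup E'] [NormedSpace ℝ E'] [ChartedSpace E Γ] [ChartedSpace E' M]
    (s t : Γ → M) (g : Γ) : ℕ :=
  finrank ℝ ((LinearMap.ker (tangentMapAt t g : E →ₗ[ℝ] E')).map (tangentMapAt s g : E →ₗ[ℝ] E'))

variable {s t : Γ → M}

/-- The family `d` has the same values of `s` as the parametrization and stays in one fibre of `t`.
Its derivative therefore takes values in ker dt, and ds has the same image along both families. This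
is the form in which a left translation acts. -/
theorem fibreRank_le_of_fibreParam [FiniteDimensional ℝ E'] (hs : MDifferentiable 𝓘(ℝ, E) 𝓘(ℝ, E') s)
    (ht : MDifferentiable 𝓘(ℝ, E) 𝓘(ℝ, E') t) {g : Γ}
    (c : FibreParam (E := E) (E' := E') t g F) {d : F → Γ}
    (hd : MDifferentiableAt 𝓘(ℝ, F) 𝓘(ℝ, E) d c.pt)
    (hsd : ∀ v ∈ c.dom, s (d v) = s (c.toFun v)) (htd : ∀ v ∈ c.dom, t (d v) = t (d c.pt)) :
    fibreRank E E' s t g ≤ fibreRank E E' s t (d c.pt) := by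
  have hc : MDifferentiableAt 𝓘(ℝ, F) 𝓘(ℝ, E) c.toFun c.pt :=
    (c.contMDiffOn.contMDiffAt (c.isOpen.mem_nhds c.mem)).mdifferentiableAt (by simp)
  have h1 : (tangentMapAt s (c.toFun c.pt) : E →ₗ[ℝ] E').comp (tangentMapAt c.toFun c.pt : F →ₗ[ℝ] E) =
      (tangentMapAt s (d c.pt) : E →ₗ[ℝ] E').comp (tangentMapAt d c.pt : F →ₗ[ℝ] E) := by
    rw [← tangentMapAt_comp (hs _) hc, ← tangentMapAt_comp (hs _) hd]
    refine tangentMapAt_congr ?_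
    filter_upwards [c.isOpen.mem_nhds c.mem] with v hv
    exact (hsd v hv).symm
  have h2 : (tangentMapAt t (d c.pt) : E →ₗ[ℝ] E').comp (tangentMapAt d c.pt : F →ₗ[ℝ] E) = 0 := by
    rw [← tangentMapAt_comp (ht _) hd, ← tangentMapAt_const (t (d c.pt)) c.pt]
    refine tangentMapAt_congr ?_
    filter_upwards [c.isOpen.mem_nhds c.mem] with v hv
    exact htd v hv
  have h3 : fibreRank E E' s t g = fibreRank E E' s t (c.toFun c.pt) :=
    congrArg (fibreRank E E' s t) c.map_pt.symm
  rw [h3]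
  refine Submodule.finrank_mono ?_
  rintro _ ⟨w, hw, rfl⟩
  obtain ⟨η, rfl⟩ := c.mem_range c.pt c.mem w hw
  exact ⟨tangentMapAt d c.pt η, LinearMap.congr_fun h2 η, (LinearMap.congr_fun h1 η).symm⟩

/-- The derivative of the parametrization has range exactly ker dt, and that of the chart `ψ` is
injective, so it does not change the dimension of the image. -/
theorem finrank_range_fderiv_of_fibreParam [IsManifold 𝓘(ℝ, E') ∞ M]
    {ψ : OpenPartialHomeomorph M E'}
    (hψ : ψ ∈ IsManifold.maximalAtlas 𝓘(ℝ, E') ∞ M) (hψu : ψ.source = univ)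
    (hs : MDifferentiable 𝓘(ℝ, E) 𝓘(ℝ, E') s)
    (ht : MDifferentiable 𝓘(ℝ, E) 𝓘(ℝ, E') t) {g : Γ}
    (c : FibreParam (E := E) (E' := E') t g F) {v : F} (hv : v ∈ c.dom) :
    finrank ℝ (LinearMap.range (fderiv ℝ (fun v => ψ (s (c.toFun v))) v : F →ₗ[ℝ] E')) =
      fibreRank E E' s t (c.toFun v) := by
  have hψd := mdifferentiable_of_mem_maximalAtlas hψ
  have hu : ∀ X, X ∈ ψ.source := fun X => hψu ▸ mem_univ X
  have hc : MDifferentiableAt 𝓘(ℝ, F) 𝓘(ℝ, E) c.toFun v :=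
    (c.contMDiffOn.contMDiffAt (c.isOpen.mem_nhds hv)).mdifferentiableAt (by simp)
  have h1 : (fderiv ℝ (fun v => ψ (s (c.toFun v))) v : F →ₗ[ℝ] E') =
      (tangentMapAt ψ (s (c.toFun v)) : E' →ₗ[ℝ] E').comp
        ((tangentMapAt s (c.toFun v) : E →ₗ[ℝ] E').comp (tangentMapAt c.toFun v : F →ₗ[ℝ] E)) := by
    have hsc : MDifferentiableAt 𝓘(ℝ, F) 𝓘(ℝ, E') (fun v => s (c.toFun v)) v := (hs _).comp v hc
    rw [← tangentMapAt_comp (hs _) hc,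
      ← tangentMapAt_comp (h := fun v => s (c.toFun v)) (hψd.mdifferentiableAt (hu _)) hsc,
      tangentMapAt, mfderiv_eq_fderiv]
  have h2 : LinearMap.range (tangentMapAt c.toFun v : F →ₗ[ℝ] E) =
      LinearMap.ker (tangentMapAt t (c.toFun v) : E →ₗ[ℝ] E') := by
    refine le_antisymm ?_ fun w hw => (c.mem_range v hv w hw).imp fun _ h => h
    rw [LinearMap.range_le_ker_iff, ← tangentMapAt_comp (ht _) hc, ← tangentMapAt_const (t g) v]
    refine tangentMapAt_congr ?_
    filter_upwards [c.isOpen.mem_nhds hv] with v hv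
    exact c.apply_eq v hv
  have h3 : Function.Injective (tangentMapAt ψ (s (c.toFun v)) : E' →ₗ[ℝ] E') :=
    hψd.mfderiv_injective (hu _)
  rw [h1, LinearMap.range_comp, LinearMap.range_comp, h2]
  exact ((Submodule.equivMapOfInjective _ h3 _).finrank_eq).symm

end Rank

/-! ### Constancy of the rank on a transitive Lie groupoid. -/

section LieGroupoid

universe u

variable {E : Type u} {E' Γ M : Type*} [NormedAddCommGroup E] [NormedSpace ℝ E]
  [NormedAddCommGroup E'] [NormedSpace ℝ E']
  [TopologicalSpace Γ] [ChartedSpace E Γ] [TopologicalSpace M] [ChartedSpace E' M]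
  {G : GroupoidOver Γ M}

/-- Left translation by `a` preserves sources and carries the target fibre of `g` into that of the
composite. -/
theorem GroupoidOver.IsLieGroupoid.fibreRank_le_comp [FiniteDimensional ℝ E']
    (hG : G.IsLieGroupoid 𝓘(ℝ, E) 𝓘(ℝ, E'))
    (a g : Γ) (e : G.src a = G.tgt g) :
    fibreRank E E' G.src G.tgt g ≤ fibreRank E E' G.src G.tgt (G.comp a g e) := by
  have := hG.isManifold_arrows
  have := hG.isManifold_objects
  obtain ⟨c⟩ := exists_fibreParam (hG.isSubmersion_tgt g)
  have hm : ∀ v ∈ c.dom, (a, c.toFun v) ∈ G.composable := fun v hv =>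
    e.trans (c.apply_eq v hv).symm
  have hd : ContMDiffOn 𝓘(ℝ, (hG.isSubmersion_tgt g).complement) 𝓘(ℝ, E) ∞
      (fun v => G.compFun (a, c.toFun v)) c.dom :=
    hG.contMDiffOn_comp.comp (contMDiffOn_const.prodMk c.contMDiffOn) hm
  have hcf : ∀ v (hv : v ∈ c.dom), G.compFun (a, c.toFun v) = G.comp a (c.toFun v) (hm v hv) :=
    fun v hv => dif_pos (hm v hv)
  have key := fibreRank_le_of_fibreParam (hG.contMDiff_src.mdifferentiable (by simp))
    (hG.contMDiff_tgt.mdifferentiable (by simp)) c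
    ((hd.contMDiffAt (c.isOpen.mem_nhds c.mem)).mdifferentiableAt (by simp))
    (fun v hv => (congrArg G.src (hcf v hv)).trans (G.src_comp _ _ _))
    (fun v hv => ((congrArg G.tgt (hcf v hv)).trans (G.tgt_comp _ _ _)).trans
      ((congrArg G.tgt (hcf _ c.mem)).trans (G.tgt_comp _ _ _)).symm)
  have h1 : G.compFun (a, c.toFun c.pt) = G.comp a g e := by
    have h2 : G.compFun (a, g) = G.comp a g e := dif_pos e
    rw [← h2]
    exact congrArg (fun k => G.compFun (a, k)) c.map_pt
  exact key.trans (congrArg (fibreRank E E' G.src G.tgt) h1).le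

/-- Inversion exchanges source and target, hence turns the rank of t along the fibres of s at `g`
into that of s along the fibres of t at the inverse. By `finrank_map_ker_comm` the former equals the
rank of s along the fibres of t at `g`. -/
theorem GroupoidOver.IsLieGroupoid.fibreRank_le_inv [FiniteDimensional ℝ E]
    (hG : G.IsLieGroupoid 𝓘(ℝ, E) 𝓘(ℝ, E'))
    (g : Γ) :
    fibreRank E E' G.src G.tgt g ≤ fibreRank E E' G.src G.tgt (G.inv g) := by
  have := hG.isManifold_arrows
  have := hG.isManifold_objects
  have hi : MDifferentiableAt 𝓘(ℝ, E) 𝓘(ℝ, E) G.inv g :=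
    (hG.contMDiff_inv.mdifferentiable (by simp)) g
  have h1 : (tangentMapAt G.src (G.inv g) : E →ₗ[ℝ] E').comp (tangentMapAt G.inv g : E →ₗ[ℝ] E) =
      tangentMapAt G.tgt g := by
    rw [← tangentMapAt_comp (hG.contMDiff_src.mdifferentiable (by simp) _) hi]
    simp only [G.src_inv]
  have h2 : (tangentMapAt G.tgt (G.inv g) : E →ₗ[ℝ] E').comp (tangentMapAt G.inv g : E →ₗ[ℝ] E) =
      tangentMapAt G.src g := by
    rw [← tangentMapAt_comp (hG.contMDiff_tgt.mdifferentiable (by simp) _) hi]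
    simp only [G.tgt_inv]
  have hs : Function.Surjective (tangentMapAt G.src g : E →ₗ[ℝ] E') :=
    surjective_mfderiv_of_isSubmersionAt (hG.isSubmersion_src g)
  have ht : Function.Surjective (tangentMapAt G.tgt g : E →ₗ[ℝ] E') :=
    surjective_mfderiv_of_isSubmersionAt (hG.isSubmersion_tgt g)
  rw [fibreRank, finrank_map_ker_comm hs ht]
  refine Submodule.finrank_mono ?_
  rintro _ ⟨w, hw, rfl⟩
  exact ⟨tangentMapAt G.inv g w, (LinearMap.congr_fun h2 w).trans hw, LinearMap.congr_fun h1 w⟩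

theorem GroupoidOver.IsLieGroupoid.fibreRank_comp [FiniteDimensional ℝ E']
    (hG : G.IsLieGroupoid 𝓘(ℝ, E) 𝓘(ℝ, E'))
    (a g : Γ) (e : G.src a = G.tgt g) :
    fibreRank E E' G.src G.tgt (G.comp a g e) = fibreRank E E' G.src G.tgt g := by
  refine le_antisymm ?_ (hG.fibreRank_le_comp a g e)
  have e' : G.src (G.inv a) = G.tgt (G.comp a g e) := by rw [G.src_inv, G.tgt_comp]
  have h1 := hG.fibreRank_le_comp (G.inv a) (G.comp a g e) e'
  have h2 : G.comp (G.inv a) (G.comp a g e) e' = g := by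
    rw [G.comp_assoc (G.inv a) a g (G.src_inv a) e]
    simp only [G.inv_comp, e, G.one_comp]
  rwa [h2] at h1

/-- Translating by the inverse of `g` reduces the rank to the identity of its source; inversion
bounds it by the rank at the identity of its target. An arrow between two given points, and one in
the opposite direction, then equate the ranks at their identities. -/
theorem GroupoidOver.IsLieGroupoid.fibreRank_eq [FiniteDimensional ℝ E] [FiniteDimensional ℝ E']
    (hG : G.IsLieGroupoid 𝓘(ℝ, E) 𝓘(ℝ, E'))
    (hT : G.IsTransitive) (g g' : Γ) :
    fibreRank E E' G.src G.tgt g = fibreRank E E' G.src G.tgt g' := by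
  have h1 : ∀ g, fibreRank E E' G.src G.tgt g = fibreRank E E' G.src G.tgt (G.one (G.src g)) := by
    intro g
    rw [← G.inv_comp, hG.fibreRank_comp]
  have h2 : ∀ g, fibreRank E E' G.src G.tgt g ≤ fibreRank E E' G.src G.tgt (G.one (G.tgt g)) := by
    intro g
    rw [← G.src_inv, ← h1]
    exact hG.fibreRank_le_inv g
  have h3 : ∀ x y, fibreRank E E' G.src G.tgt (G.one x) ≤ fibreRank E E' G.src G.tgt (G.one y) := by
    intro x y
    obtain ⟨k, hk⟩ := hT (x, y)
    obtain ⟨rfl, rfl⟩ := Prod.ext_iff.1 hk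
    rw [← h1]
    exact h2 k
  rw [h1 g, h1 g']
  exact le_antisymm (h3 _ _) (h3 _ _)

end LieGroupoid

end

section

open Set Module

/-! ### Local sections of a transitive Lie groupoid. -/

section LocalSections

universe u

variable {E : Type u} {E' Γ M : Type*} [NormedAddCommGroup E] [NormedSpace ℝ E]
  [FiniteDimensional ℝ E] [NormedAddCommGroup E'] [NormedSpace ℝ E']
  [TopologicalSpace Γ] [ChartedSpace E Γ] [TopologicalSpace M] [ChartedSpace E' M]
  {G : GroupoidOver Γ M} {ψ : OpenPartialHomeomorph M E'}

theorem finiteDimensional_complement {t : Γ → M} {g : Γ}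
    (h : Manifold.IsSubmersionAt 𝓘(ℝ, E) 𝓘(ℝ, E') ∞ t g) : FiniteDimensional ℝ h.complement :=
  Module.Finite.of_surjective ((LinearMap.snd ℝ E' h.complement).comp
    (h.equiv : E →ₗ[ℝ] E' × h.complement))
    (Prod.snd_surjective.comp h.equiv.surjective)

variable [FiniteDimensional ℝ E']

/-- The source map of a transitive Lie groupoid restricts to submersions on the fibres of the target
map. -/
theorem GroupoidOver.IsLieGroupoid.fibreRank_eq_finrank [SecondCountableTopology Γ]
    (hG : G.IsLieGroupoid 𝓘(ℝ, E) 𝓘(ℝ, E')) (hT : G.IsTransitive)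
    (hψ : ψ ∈ IsManifold.maximalAtlas 𝓘(ℝ, E') ∞ M) (hψu : ψ.source = univ) (g : Γ) :
    fibreRank E E' G.src G.tgt g = finrank ℝ E' := by
  have := hG.isManifold_arrows
  have := hG.isManifold_objects
  set ρ := fibreRank E E' G.src G.tgt g with hρ
  refine le_antisymm (Submodule.finrank_le _) ?_
  -- The rank of s on target fibres being constantly ρ, small pieces of them have image of Hausdorff
  -- dimension at most ρ.
  have hcov : ∀ k : Γ, ∃ S ∈ 𝓝[G.tgt ⁻¹' {G.tgt k}] k, dimH ((fun γ => ψ (G.src γ)) '' S) ≤ ρ := by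
    intro k
    have hk := hG.isSubmersion_tgt k
    have := finiteDimensional_complement hk
    obtain ⟨c⟩ := exists_fibreParam hk
    have hf : ContDiffOn ℝ ∞ (fun v => ψ (G.src (c.toFun v))) c.dom :=
      ((contMDiff_of_mem_maximalAtlas hψ hψu).comp_contMDiffOn
        (hG.contMDiff_src.comp_contMDiffOn c.contMDiffOn)).contDiffOn
    obtain ⟨N, hN, hd⟩ := exists_dimH_image_le_of_finrank_range_eq c.isOpen hf (r := ρ)
      (fun v hv => (finrank_range_fderiv_of_fibreParam hψ hψu
        (hG.contMDiff_src.mdifferentiable (by simp))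
        (hG.contMDiff_tgt.mdifferentiable (by simp)) c hv).trans (hG.fibreRank_eq hT _ _)) c.mem
    refine ⟨_, c.image_mem_nhds N hN, (dimH_mono ?_).trans hd⟩
    rw [image_image]
    exact image_mono inter_subset_left
  choose S hS hdim using hcov
  -- Second countability is essential here: Hausdorff dimension is controlled only under countable
  -- unions.
  obtain ⟨C, -, hC, hsub⟩ := TopologicalSpace.countable_cover_nhdsWithin
    (s := G.tgt ⁻¹' {G.tgt g}) (f := S) (fun k hk => by
      have h := hS k
      rwa [show G.tgt k = G.tgt g from hk] at h)
  have hle : dimH (range ψ) ≤ ρ := by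
    -- By transitivity every point of `M` is the source of an arrow in the chosen target fibre.
    have h1 : range ψ ⊆ ⋃ k ∈ C, (fun γ => ψ (G.src γ)) '' S k := by
      rintro _ ⟨Z, rfl⟩
      obtain ⟨γ, hγ⟩ := hT (Z, G.tgt g)
      obtain ⟨h2, h3⟩ := Prod.ext_iff.1 hγ
      obtain ⟨k, hkC, hkS⟩ := mem_iUnion₂.1 (hsub (show γ ∈ G.tgt ⁻¹' {G.tgt g} from h3))
      exact mem_iUnion₂.2 ⟨k, hkC, γ, hkS, congrArg ψ h2⟩
    refine (dimH_mono h1).trans ?_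
    rw [dimH_bUnion hC]
    exact iSup₂_le fun k _ => hdim k
  have hnhds : range ψ ∈ 𝓝 (ψ (G.src g)) := by
    refine Filter.mem_of_superset (ψ.open_target.mem_nhds (ψ.map_source (hψu ▸ mem_univ _))) ?_
    rw [← ψ.image_source_eq_target]
    exact image_subset_range _ _
  rw [Real.dimH_of_mem_nhds hnhds] at hle
  exact_mod_cast hle

/-- Every arrow of a transitive Lie groupoid is a value of a smooth local section of the source map
with values in a fibre of the target map. -/
theorem GroupoidOver.IsLieGroupoid.exists_local_section [SecondCountableTopology Γ]
    (hG : G.IsLieGroupoid 𝓘(ℝ, E) 𝓘(ℝ, E')) (hT : G.IsTransitive)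
    (hψ : ψ ∈ IsManifold.maximalAtlas 𝓘(ℝ, E') ∞ M) (hψu : ψ.source = univ) (g : Γ) :
    ∃ (U : Set M) (σ : M → Γ), IsOpen U ∧ G.src g ∈ U ∧ ContMDiffOn 𝓘(ℝ, E') 𝓘(ℝ, E) ∞ σ U ∧
      σ (G.src g) = g ∧ ∀ Z ∈ U, G.src (σ Z) = Z ∧ G.tgt (σ Z) = G.tgt g := by
  have := hG.isManifold_arrows
  have := hG.isManifold_objects
  have hg := hG.isSubmersion_tgt g
  have := finiteDimensional_complement hg
  have := FiniteDimensional.complete ℝ hg.complement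
  obtain ⟨c⟩ := exists_fibreParam hg
  have hψs := contMDiff_of_mem_maximalAtlas hψ hψu
  have hf : ContDiffOn ℝ ∞ (fun v => ψ (G.src (c.toFun v))) c.dom :=
    (hψs.comp_contMDiffOn (hG.contMDiff_src.comp_contMDiffOn c.contMDiffOn)).contDiffOn
  have hsurj : Function.Surjective (fderiv ℝ (fun v => ψ (G.src (c.toFun v))) c.pt) := by
    refine LinearMap.range_eq_top.1 (Submodule.eq_top_of_finrank_eq
      (S := LinearMap.range (fderiv ℝ (fun v => ψ (G.src (c.toFun v))) c.pt :
        hg.complement →ₗ[ℝ] E')) ?_)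
    rw [finrank_range_fderiv_of_fibreParam hψ hψu (hG.contMDiff_src.mdifferentiable (by simp))
        (hG.contMDiff_tgt.mdifferentiable (by simp)) c c.mem]
    exact hG.fibreRank_eq_finrank hT hψ hψu _
  obtain ⟨U, r, hU, hmem, hr, hr0, hrO, hfr⟩ := exists_smooth_rightInverse c.isOpen hf c.mem hsurj
  have hpt : G.src (c.toFun c.pt) = G.src g := congrArg G.src c.map_pt
  simp only [hpt] at hmem hr0
  refine ⟨ψ ⁻¹' U, fun Z => c.toFun (r (ψ Z)), hU.preimage hψs.continuous, hmem,
    c.contMDiffOn.comp (hr.contMDiffOn.comp hψs.contMDiffOn fun _ h => h) fun Z hZ => hrO _ hZ,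
    ?_, fun Z hZ => ⟨?_, c.apply_eq _ (hrO _ hZ)⟩⟩
  · simp only [hr0, c.map_pt]
  · exact ψ.injOn (hψu ▸ mem_univ _) (hψu ▸ mem_univ _) (hfr _ hZ)

end LocalSections

/-! ### From a transitive Lie subgroupoid to smooth uniformity. -/

variable {B V : Type*} [TopologicalSpace B] [ChartedSpace E3 B] {W : Jet B → V}

theorem IsUniform.isTransitive (hW : IsUniform W) : (materialGroupoid W).toGroupoid.IsTransitive := by
  rintro ⟨X, Y⟩
  obtain ⟨g, hg, rfl, rfl⟩ := hW X Y
  exact ⟨⟨g, hg⟩, rfl⟩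

variable [Body B]

/-- A local section of the source map inside a target fibre, composed with the inclusion, is a
smooth field. Only smoothness of the inclusion matters, so the immersed case suffices; the
neighbourhood may be the whole body. -/
theorem isSmoothlyUniform_of_isLieSubgroupoid
    (hT : (materialGroupoid W).toGroupoid.IsTransitive)
    (hL : (materialGroupoid W).IsLieSubgroupoid 𝓘(ℝ, Jet.Model) (𝓡 3)) : IsSmoothlyUniform W := by
  obtain ⟨k, _, _, _, _, himm, hG⟩ := hL
  have hincl := himm.contMDiff
  refine ⟨fun X Y => ?_, fun X => ⟨univ, Filter.univ_mem, ?_⟩⟩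
  · obtain ⟨g, hg⟩ := hT (X, Y)
    exact ⟨g.1, g.2, congrArg Prod.fst hg, congrArg Prod.snd hg⟩
  · rintro _ - g hg rfl rfl
    obtain ⟨U, σ, hU, hgU, hσ, hσg, hσU⟩ := hG.exists_local_section hT
      refHomeo_mem_maximalAtlas refHomeo_source ⟨g, hg⟩
    exact ⟨U, fun Z => (materialGroupoid W).incl (σ Z), hgU,
      ⟨hU, hincl.comp_contMDiffOn hσ, fun Z _ => (σ Z).2, fun Z hZ => (hσU Z hZ).1,
        fun Z hZ => (hσU Z hZ).2⟩, congrArg (materialGroupoid W).incl hσg⟩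

theorem Subgroupoid.IsEmbeddedLieSubgroupoid.isLieSubgroupoid
    {S : Subgroupoid (jetGroupoid B)}
    (h : S.IsEmbeddedLieSubgroupoid 𝓘(ℝ, Jet.Model) (𝓡 3)) :
    S.IsLieSubgroupoid 𝓘(ℝ, Jet.Model) (𝓡 3) := by
  obtain ⟨k, τ, κ, h1, h2, h3, h4⟩ := h
  exact ⟨k, τ, κ, h1, h2, h3.isImmersion, h4⟩

end

end Material

end

theorem mainTheorem7 {B : Type*} [TopologicalSpace B] [ChartedSpace E3 B] [Body B]
    {V : Type*} [NormedAddCommGroup V] [NormedSpace ℝ V]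
    (W : Jet B → V) (hW : IsMechanicalResponse W) :
    (IsSmoothlyUniform W ↔
      (materialGroupoid W).toGroupoid.IsTransitive ∧
        (materialGroupoid W).IsLieSubgroupoid 𝓘(ℝ, Jet.Model) (𝓡 3)) ∧
    (IsSmoothlyUniform W ↔
      (materialGroupoid W).toGroupoid.IsTransitive ∧
        (materialGroupoid W).IsEmbeddedLieSubgroupoid 𝓘(ℝ, Jet.Model) (𝓡 3)) := by
  have key : IsSmoothlyUniform W →
      (materialGroupoid W).IsEmbeddedLieSubgroupoid 𝓘(ℝ, Jet.Model) (𝓡 3) :=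
    isEmbeddedLieSubgroupoid_of_isSmoothlyUniform hW.contMDiff.continuous
  exact ⟨⟨fun h => ⟨h.1.isTransitive, (key h).isLieSubgroupoid⟩,
    fun h => isSmoothlyUniform_of_isLieSubgroupoid h.1 h.2⟩,
    ⟨fun h => ⟨h.1.isTransitive, key h⟩,
    fun h => isSmoothlyUniform_of_isLieSubgroupoid h.1 h.2.isLieSubgroupoid⟩⟩
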